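/- Let $n\ge 0$. A $C^\infty$-ring is a set $A$ with a $k$-ary operation $A^k\to A$ for every smooth $g:\mathbb{R}^k\to\mathbb{R}$ ($k\ge 0$), compatibly with projections and composition; it has an underlying commutative ring, and for an ideal $I$ of this ring the quotient $A/I$ is again a $C^\infty$-ring. For $i,j\in\{1,\dots,n\}$ let $\pi_i:\mathbb{R}^n\to\mathbb{R}$ be the coordinates and let $I_n=\langle \pi_i\pi_j : 1\le i,j\le n\rangle\subseteq C^\infty(\mathbb{R}^n)$. Let $\mathrm{Inf}_n$ be the cosimplicial $C^\infty$-ring with $$(\mathrm{Inf}_n)_m = C^\infty\big((\mathbb{R}^n)^{m+1}\big)\Big/\sum_{k,l=0}^{m} I_n\circ(\pi_k-\pi_l),$$ where $\pi_k:(\mathbb{R}^n)^{m+1}\to\mathbb{R}^n$, $(x_0,\dots,x_m)\mapsto x_k$, and $I_n\circ(\pi_k-\pi_l)$ denotes the ideal generated by the functions $h\circ(\pi_k-\pi_l)$ with $h\in I_n$; a monotone map $\theta:[m]\to[m']$ acts by $[f]\mapsto[(x_0,\dots,x_{m'})\mapsto f(x_{\theta(0)},\dots,x_{\theta(m)})]$.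 For a cosimplicial abelian group $X$ with coface maps $d^i$, the normalized cochain complex $N(X)$ is given by $N(X)^m=X^m/\sum_{i=1}^{m}d^i(X^{m-1})$ with the differential induced by $d^0$. **Theorem.** There is an isomorphism of cochain complexes of abelian groups $\Phi: N(\mathrm{Inf}_n)\to \Omega^\bullet(\mathbb{R}^n)$ from the normalized cochain complex of the underlying cosimplicial abelian group of $\mathrm{Inf}_n$ to the de Rham complex of $\mathbb{R}^n$ such that for every $m\ge 0$ and every $f\in C^\infty((\mathbb{R}^n)^{m+1})$, viewed as a function of $(x_0,\dots,x_m)$ with $x_i=(x_{i,1},\dots,x_{i,n})$, $$\Phi_m([f])(x)=\sum_{\alpha:\{1,\dots,m\}\hookrightarrow\{1,\dots,n\}} \frac{\partial^m f}{\partial x_{1,\alpha(1)}\cdots\partial x_{m,\alpha(m)}}(x,x,\dots,x)\; dx_{\alpha(1)}\wedge\dots\wedge dx_{\alpha(m)},$$ the sum being over all injections $\alpha$, with $(dx_{\alpha(1)}\wedge\dots\wedge dx_{\alpha(m)})(v_1,\dots,v_m)=\det\big((v_i)_{\alpha(j)}\big)_{i,j}$. In particular $\Phi$ intertwines the $0$-th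 coface map with the exterior derivative: $\Phi_{m+1}([d^0a])=d\,\Phi_m([a])$ for all $a\in(\mathrm{Inf}_n)_m$. Here $d\eta(v_0,\dots,v_m)=\sum_i(-1)^i (D_{v_i}\eta)(v_0,\dots,\widehat{v_i},\dots,v_m)$ for an $m$-form $\eta$. -/

import Mathlib

open CategoryTheory
open scoped ContDiff Topology

noncomputable section

namespace CInf

/-! ## Smooth functions and `C^∞`-rings -/

/-- Smooth real-valued functions on a normed space. -/
@[ext]
structure SmoothFn (V : Type) [NormedAddCommGroup V] [NormedSpace ℝ V] : Type where
  toFun : V → ℝ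
  smooth : ContDiff ℝ ∞ toFun

namespace SmoothFn

variable {V W : Type} [NormedAddCommGroup V] [NormedSpace ℝ V]
  [NormedAddCommGroup W] [NormedSpace ℝ W]

instance : CoeFun (SmoothFn V) (fun _ => V → ℝ) := ⟨SmoothFn.toFun⟩

/-- The coordinate functions on `ℝ^k`. -/
def proj {k : ℕ} (i : Fin k) : SmoothFn (Fin k → ℝ) := ⟨fun x => x i, by fun_prop⟩

/-- The composite of `g : ℝ^k → ℝ` with a `k`-tuple of smooth functions on `V`. -/
def comp {k : ℕ} (g : SmoothFn (Fin k → ℝ)) (f : Fin k → SmoothFn V) : SmoothFn V :=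
  ⟨fun x => g (fun i => f i x), g.2.comp (contDiff_pi.2 fun i => (f i).2)⟩

/-- Precomposition with a continuous linear map. -/
def pull (L : V →L[ℝ] W) (f : SmoothFn W) : SmoothFn V :=
  ⟨fun x => f (L x), f.2.comp L.contDiff⟩

end SmoothFn

/-- A `C^∞`-ring: a set with a `k`-ary operation for each smooth function `ℝ^k → ℝ` (for all `k`),
such that projections act as projections and composites act as composites. Equivalently, a
product-preserving functor to sets from the category of the spaces `ℝ^k` and smooth maps. -/
structure CInfRing : Type 1 where
  carrier : Type
  op : ∀ {k : ℕ}, SmoothFn (Fin k → ℝ) → (Fin k → carrier) → carrier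
  op_proj : ∀ {k : ℕ} (i : Fin k) (a : Fin k → carrier), op (SmoothFn.proj i) a = a i
  op_comp : ∀ {k l : ℕ} (g : SmoothFn (Fin k → ℝ)) (f : Fin k → SmoothFn (Fin l → ℝ))
    (a : Fin l → carrier), op (g.comp f) a = op g (fun i => op (f i) a)

namespace CInfRing

instance : CoeSort CInfRing Type := ⟨CInfRing.carrier⟩

/-- Morphisms of `C^∞`-rings: maps that commute with all the operations. -/
@[ext]
structure Hom (A B : CInfRing) : Type where
  toFun : A → B
  map_op : ∀ {k : ℕ} (f : SmoothFn (Fin k → ℝ)) (a : Fin k → A),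
    toFun (A.op f a) = B.op f (fun i => toFun (a i))

instance : Category CInfRing where
  Hom := Hom
  id A := ⟨id, fun _ _ => rfl⟩
  comp f g := ⟨g.toFun ∘ f.toFun, fun h a => by simp [f.map_op, g.map_op]⟩

/-! ### The underlying commutative ring -/

/-- Smooth functions giving the ring operations. -/
def addFn : SmoothFn (Fin 2 → ℝ) := ⟨fun x => x 0 + x 1, by fun_prop⟩
def mulFn : SmoothFn (Fin 2 → ℝ) := ⟨fun x => x 0 * x 1, by fun_prop⟩
def negFn : SmoothFn (Fin 1 → ℝ) := ⟨fun x => - x 0, by fun_prop⟩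
def zeroFn : SmoothFn (Fin 0 → ℝ) := ⟨fun _ => 0, by fun_prop⟩
def oneFn : SmoothFn (Fin 0 → ℝ) := ⟨fun _ => 1, by fun_prop⟩

variable (A : CInfRing)

instance : Add A := ⟨fun a b => A.op addFn ![a, b]⟩
instance : Mul A := ⟨fun a b => A.op mulFn ![a, b]⟩
instance : Neg A := ⟨fun a => A.op negFn ![a]⟩
instance : Zero A := ⟨A.op zeroFn ![]⟩
instance : One A := ⟨A.op oneFn ![]⟩

theorem op_comp_eq {k l : ℕ} {g : SmoothFn (Fin k → ℝ)} {f : Fin k → SmoothFn (Fin l → ℝ)}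
    {h : SmoothFn (Fin l → ℝ)} (e : ∀ x, h x = g (fun i => f i x)) (a : Fin l → A)
    (b : Fin k → A) (hb : ∀ i, b i = A.op (f i) a) : A.op g b = A.op h a := by
  have : h = g.comp f := SmoothFn.ext (funext e)
  rw [this, A.op_comp, funext hb]

theorem op_add {l : ℕ} (f g : SmoothFn (Fin l → ℝ)) (a : Fin l → A) :
    A.op f a + A.op g a = A.op ⟨fun x => f x + g x, f.2.add g.2⟩ a :=
  A.op_comp_eq (f := ![f, g]) (fun _ => rfl) a _ (by simp [Fin.forall_fin_two])

theorem op_mul {l : ℕ} (f g : SmoothFn (Fin l → ℝ)) (a : Fin l → A) :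
    A.op f a * A.op g a = A.op ⟨fun x => f x * g x, f.2.mul g.2⟩ a :=
  A.op_comp_eq (f := ![f, g]) (fun _ => rfl) a _ (by simp [Fin.forall_fin_two])

theorem op_neg {l : ℕ} (f : SmoothFn (Fin l → ℝ)) (a : Fin l → A) :
    - A.op f a = A.op ⟨fun x => - f x, f.2.neg⟩ a :=
  A.op_comp_eq (f := ![f]) (fun _ => rfl) a _ (by simp)

theorem op_zero {l : ℕ} (a : Fin l → A) : (0 : A) = A.op ⟨fun _ => 0, contDiff_const⟩ a :=
  A.op_comp_eq (f := ![]) (fun _ => rfl) a _ (fun i => i.elim0)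

theorem op_one {l : ℕ} (a : Fin l → A) : (1 : A) = A.op ⟨fun _ => 1, contDiff_const⟩ a :=
  A.op_comp_eq (f := ![]) (fun _ => rfl) a _ (fun i => i.elim0)

theorem exists_eq_op (a b c : A) : ∃ (v : Fin 3 → A) (f g h : SmoothFn (Fin 3 → ℝ)),
    a = A.op f v ∧ b = A.op g v ∧ c = A.op h v :=
  ⟨![a, b, c], .proj 0, .proj 1, .proj 2, by simp [A.op_proj]⟩

theorem op_congr {l : ℕ} {f g : SmoothFn (Fin l → ℝ)} (a : Fin l → A) (h : ∀ x, f x = g x) :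
    A.op f a = A.op g a := by
  rw [show f = g from SmoothFn.ext (funext h)]

/-- The underlying commutative ring of a `C^∞`-ring. -/
instance : CommRing A where
  add_assoc a b c := by
    obtain ⟨v, f, g, h, rfl, rfl, rfl⟩ := A.exists_eq_op a b c
    simp only [op_add]; exact A.op_congr v fun x => add_assoc _ _ _
  zero_add a := by
    obtain ⟨v, f, g, h, rfl, -⟩ := A.exists_eq_op a a a
    rw [A.op_zero v, op_add]; exact A.op_congr v fun x => zero_add _
  add_zero a := by
    obtain ⟨v, f, g, h, rfl, -⟩ := A.exists_eq_op a a a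
    rw [A.op_zero v, op_add]; exact A.op_congr v fun x => add_zero _
  add_comm a b := by
    obtain ⟨v, f, g, h, rfl, rfl, -⟩ := A.exists_eq_op a b b
    simp only [op_add]; exact A.op_congr v fun x => add_comm _ _
  left_distrib a b c := by
    obtain ⟨v, f, g, h, rfl, rfl, rfl⟩ := A.exists_eq_op a b c
    simp only [op_add, op_mul]; exact A.op_congr v fun x => left_distrib _ _ _
  right_distrib a b c := by
    obtain ⟨v, f, g, h, rfl, rfl, rfl⟩ := A.exists_eq_op a b c
    simp only [op_add, op_mul]; exact A.op_congr v fun x => right_distrib _ _ _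
  zero_mul a := by
    obtain ⟨v, f, g, h, rfl, -⟩ := A.exists_eq_op a a a
    rw [A.op_zero v, op_mul]; exact A.op_congr v fun x => zero_mul _
  mul_zero a := by
    obtain ⟨v, f, g, h, rfl, -⟩ := A.exists_eq_op a a a
    rw [A.op_zero v, op_mul]; exact A.op_congr v fun x => mul_zero _
  mul_assoc a b c := by
    obtain ⟨v, f, g, h, rfl, rfl, rfl⟩ := A.exists_eq_op a b c
    simp only [op_mul]; exact A.op_congr v fun x => mul_assoc _ _ _
  one_mul a := by
    obtain ⟨v, f, g, h, rfl, -⟩ := A.exists_eq_op a a a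
    rw [A.op_one v, op_mul]; exact A.op_congr v fun x => one_mul _
  mul_one a := by
    obtain ⟨v, f, g, h, rfl, -⟩ := A.exists_eq_op a a a
    rw [A.op_one v, op_mul]; exact A.op_congr v fun x => mul_one _
  mul_comm a b := by
    obtain ⟨v, f, g, h, rfl, rfl, -⟩ := A.exists_eq_op a b b
    simp only [op_mul]; exact A.op_congr v fun x => mul_comm _ _
  neg_add_cancel a := by
    obtain ⟨v, f, g, h, rfl, -⟩ := A.exists_eq_op a a a
    rw [A.op_zero v, op_neg, op_add]; exact A.op_congr v fun x => neg_add_cancel _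
  nsmul := nsmulRec
  zsmul := zsmulRec

variable {A}

/-- The ring homomorphism underlying a morphism of `C^∞`-rings. -/
def Hom.toRingHom {A B : CInfRing} (φ : Hom A B) : A →+* B where
  toFun := φ.toFun
  map_zero' := (φ.map_op zeroFn ![]).trans (congrArg _ (funext fun i => i.elim0))
  map_one' := (φ.map_op oneFn ![]).trans (congrArg _ (funext fun i => i.elim0))
  map_add' a b := (φ.map_op addFn ![a, b]).trans
    (congrArg _ (funext fun i => by fin_cases i <;> rfl))
  map_mul' a b := (φ.map_op mulFn ![a, b]).trans
    (congrArg _ (funext fun i => by fin_cases i <;> rfl))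

/-- The functor sending a `C^∞`-ring to its underlying abelian group. -/
def underlyingAb : CInfRing ⥤ AddCommGrpCat.{0} where
  obj A := AddCommGrpCat.of A
  map φ := AddCommGrpCat.ofHom (Hom.toRingHom φ).toAddMonoidHom

/-! ### Quotients of `C^∞`-rings by ideals

By Hadamard's lemma, every ideal of the underlying ring is compatible with all the operations. -/

theorem contDiff_param {H : Type} [NormedAddCommGroup H] [NormedSpace ℝ H] [FiniteDimensional ℝ H]
    (N : ℕ) : ∀ {E : Type} [NormedAddCommGroup E] [NormedSpace ℝ E] [CompleteSpace E]
    (F : H → ℝ → E), ContDiff ℝ ∞ (Function.uncurry F) →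
      ContDiff ℝ N (fun x => ∫ t in (0:ℝ)..1, F x t) := by
  have key : ∀ {E : Type} [NormedAddCommGroup E] [NormedSpace ℝ E] [CompleteSpace E]
      (F : H → ℝ → E), ContDiff ℝ ∞ (Function.uncurry F) →
      ContDiff ℝ ∞ (Function.uncurry fun x t => fderiv ℝ (fun y => F y t) x) ∧
      ∀ x, HasFDerivAt (fun x => ∫ t in (0:ℝ)..1, F x t)
        (∫ t in (0:ℝ)..1, fderiv ℝ (fun y => F y t) x) x := by
    intro E _ _ _ F hF
    have h1 : ContDiff ℝ ∞ (Function.uncurry fun x t => fderiv ℝ (fun y => F y t) x) := by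
      have : ContDiff ℝ ∞ (fun p : H × ℝ => fderiv ℝ (fun y => F y p.2) p.1) := by
        refine ContDiff.fderiv (m := ∞) (n := ∞) (f := fun (p : H × ℝ) y => F y p.2) ?_
          contDiff_fst (by simp)
        exact hF.comp (contDiff_snd.prodMk (contDiff_snd.comp contDiff_fst))
      exact this
    refine ⟨h1, fun x => ?_⟩
    have hc : ContinuousOn (Function.uncurry fun x t => fderiv ℝ (fun y => F y t) x)
      (Metric.closedBall x 1 ×ˢ Set.Icc (0:ℝ) 1) := h1.continuous.continuousOn
    have : ProperSpace H := FiniteDimensional.proper_real H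
    obtain ⟨C, hC⟩ :=
      ((isCompact_closedBall x 1).prod isCompact_Icc).exists_bound_of_continuousOn hc
    have hFc : ∀ y, Continuous (F y) := fun y =>
      hF.continuous.comp (by fun_prop : Continuous fun t => (y, t))
    refine intervalIntegral.hasFDerivAt_integral_of_dominated_of_fderiv_le (𝕜 := ℝ) (F := F)
      (F' := fun x t => fderiv ℝ (fun y => F y t) x)
      (bound := fun _ => C) (s := Metric.ball x 1) (Metric.ball_mem_nhds x one_pos) ?_ ?_ ?_ ?_ ?_ ?_
    · exact Filter.Eventually.of_forall fun y => (hFc y).aestronglyMeasurable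
    · exact (hFc x).intervalIntegrable _ _
    · exact (h1.continuous.comp
        (by fun_prop : Continuous fun t : ℝ => (x, t))).aestronglyMeasurable
    · refine Filter.Eventually.of_forall fun t ht y hy => ?_
      rw [Set.uIoc_of_le zero_le_one] at ht
      exact hC (y, t) ⟨Metric.ball_subset_closedBall hy, ht.1.le, ht.2⟩
    · simp
    · refine Filter.Eventually.of_forall fun t ht y hy => ?_
      have : ContDiff ℝ ∞ (fun y => F y t) := hF.comp (contDiff_id.prodMk contDiff_const)
      exact (this.differentiable (by simp) y).hasFDerivAt
  induction N with
  | zero =>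
    intro E _ _ _ F hF
    have : Differentiable ℝ (fun x => ∫ t in (0:ℝ)..1, F x t) :=
      fun x => ((key F hF).2 x).differentiableAt
    exact contDiff_zero.2 this.continuous
  | succ N ih =>
    intro E _ _ _ F hF
    have := key F hF
    rw [Nat.cast_succ, contDiff_succ_iff_hasFDerivAt]
    exact ⟨_, ih _ this.1, this.2⟩

theorem hadamard {k : ℕ} (f : (Fin k → ℝ) → ℝ) (hf : ContDiff ℝ ∞ f) :
    ∃ g : Fin k → SmoothFn (Fin (k + k) → ℝ), ∀ z : Fin (k + k) → ℝ,
      f (fun i => z (Fin.castAdd k i)) =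
        f (fun i => z (Fin.natAdd k i)) +
        ∑ i, (z (Fin.castAdd k i) + - z (Fin.natAdd k i)) * g i z := by
  let p : (Fin (k + k) → ℝ) → ℝ → (Fin k → ℝ) := fun z t i =>
    z (Fin.natAdd k i) + t * (z (Fin.castAdd k i) - z (Fin.natAdd k i))
  have hp : ContDiff ℝ ∞ (Function.uncurry p) := by
    rw [contDiff_pi]; intro i
    simp only [Function.uncurry, p]
    fun_prop
  have hdf : ContDiff ℝ ∞ (fderiv ℝ f) := hf.fderiv_right (by simp)
  let G : Fin k → (Fin (k + k) → ℝ) → ℝ → ℝ := fun i z t => fderiv ℝ f (p z t) (Pi.single i 1)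
  have hG : ∀ i, ContDiff ℝ ∞ (Function.uncurry (G i)) := fun i =>
    (hdf.comp hp).clm_apply contDiff_const
  refine ⟨fun i => ⟨fun z => ∫ t in (0:ℝ)..1, G i z t, ?_⟩, fun z => ?_⟩
  · rw [contDiff_infty]
    exact fun N => contDiff_param N (G i) (hG i)
  · have hGc : ∀ i, Continuous (G i z) := fun i =>
      (hG i).continuous.comp (by fun_prop : Continuous fun t : ℝ => (z, t))
    let v : Fin k → ℝ := fun i => z (Fin.castAdd k i) - z (Fin.natAdd k i)
    have hd : ∀ t, HasDerivAt (fun t => f (p z t)) (∑ i, v i * G i z t) t := by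
      intro t
      have h1 : HasDerivAt (p z) v t := by
        rw [hasDerivAt_pi]
        intro i
        have := ((hasDerivAt_id t).mul_const (v i)).const_add (z (Fin.natAdd k i))
        rw [one_mul] at this
        exact this
      have h2 := ((hf.differentiable (by simp) (p z t)).hasFDerivAt).comp_hasDerivAt t h1
      have h3 : ∑ i, v i * G i z t = fderiv ℝ f (p z t) v := by
        have hv : v = ∑ i, v i • (Pi.single i 1 : Fin k → ℝ) := by
          ext j; simp [Finset.sum_apply, Pi.single_apply]
        rw [hv, map_sum]
        refine Finset.sum_congr rfl fun i _ => ?_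
        rw [map_smul, ← hv]; rfl
      rw [h3]
      exact h2
    have hc : Continuous fun t => ∑ i, v i * G i z t := by fun_prop
    have := intervalIntegral.integral_eq_sub_of_hasDerivAt (fun t _ => hd t)
      (hc.intervalIntegrable 0 1)
    rw [intervalIntegral.integral_finsetSum
      (fun i _ => (by fun_prop : Continuous _).intervalIntegrable 0 1)] at this
    simp only [intervalIntegral.integral_const_mul] at this
    rw [← sub_eq_iff_eq_add']
    simp only [← sub_eq_add_neg]
    refine Eq.trans ?_ this.symm
    simp [p]

theorem op_sum {l : ℕ} {ι : Type} (s : Finset ι) (F : ι → SmoothFn (Fin l → ℝ))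
    (a : Fin l → A) :
    ∑ i ∈ s, A.op (F i) a = A.op ⟨fun x => ∑ i ∈ s, F i x, ContDiff.sum fun i _ => (F i).2⟩ a := by
  classical
  induction s using Finset.induction_on with
  | empty => simpa using A.op_zero a
  | insert i s hi ih =>
    rw [Finset.sum_insert hi, ih, op_add]
    exact A.op_congr a fun x => (Finset.sum_insert (f := fun j => F j x) hi).symm

theorem op_sub_mem (I : Ideal A) {k : ℕ} (f : SmoothFn (Fin k → ℝ)) (a b : Fin k → A)
    (h : ∀ i, a i - b i ∈ I) : A.op f a - A.op f b ∈ I := by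
  obtain ⟨g, hg⟩ := hadamard f.1 f.2
  let w : Fin (k + k) → A := Fin.append a b
  have ha : ∀ i, a i = A.op (.proj (Fin.castAdd k i)) w := fun i => by simp [A.op_proj, w]
  have hb : ∀ i, b i = A.op (.proj (Fin.natAdd k i)) w := fun i => by
    rw [A.op_proj]; exact (Fin.append_right a b i).symm
  have e : A.op f a = A.op f b + ∑ i, (a i + - b i) * A.op (g i) w := by
    rw [A.op_comp_eq (f := fun i => .proj (Fin.castAdd k i))
        (h := f.comp fun i => .proj (Fin.castAdd k i)) (fun _ => rfl) w a ha,
      A.op_comp_eq (f := fun i => .proj (Fin.natAdd k i))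
        (h := f.comp fun i => .proj (Fin.natAdd k i)) (fun _ => rfl) w b hb]
    simp only [ha, hb, op_neg, op_add, op_mul, op_sum]
    refine (A.op_congr w ?_)
    exact hg
  rw [e, add_sub_cancel_left]
  refine I.sum_mem fun i _ => I.mul_mem_right _ ?_
  rw [← sub_eq_add_neg]
  exact h i

/-- The quotient of a `C^∞`-ring by an ideal of its underlying ring: the quotient set `A/I`, with
the operations computed on representatives. -/
def quotient (A : CInfRing) (I : Ideal A) : CInfRing where
  carrier := A ⧸ I
  op f a := Ideal.Quotient.mk I (A.op f fun i => (a i).out)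
  op_proj i a := by rw [A.op_proj]; exact Quotient.out_eq' _
  op_comp g f a := by
    rw [A.op_comp, Ideal.Quotient.eq]
    refine op_sub_mem I _ _ _ fun i => ?_
    rw [← Ideal.Quotient.eq]
    exact (Quotient.out_eq' _).symm

/-- The canonical morphism `A → A/I`. -/
def quotientMk (A : CInfRing) (I : Ideal A) : A ⟶ A.quotient I where
  toFun := Ideal.Quotient.mk I
  map_op f a := by
    refine Ideal.Quotient.eq.2 (op_sub_mem I _ _ _ fun i => ?_)
    rw [← Ideal.Quotient.eq]
    exact (Quotient.out_eq' _).symm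

/-- A morphism `φ : A → B` that maps the ideal `I` into the ideal `J` induces `A/I → B/J`. -/
def quotientMap {A B : CInfRing} (I : Ideal A) (J : Ideal B) (φ : A ⟶ B)
    (h : I ≤ J.comap (Hom.toRingHom φ)) : A.quotient I ⟶ B.quotient J where
  toFun := Ideal.quotientMap J (Hom.toRingHom φ) h
  map_op f a := by
    obtain ⟨b, rfl⟩ : ∃ b : Fin _ → A, a = fun i => Ideal.Quotient.mk I (b i) :=
      ⟨fun i => (a i).out, funext fun i => (Quotient.out_eq' _).symm⟩
    have h1 := ((A.quotientMk I).map_op f b).symm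
    have h2 := ((B.quotientMk J).map_op f fun i => φ.toFun (b i))
    exact (congrArg (Ideal.quotientMap J (Hom.toRingHom φ) h) h1).trans
      ((congrArg (Ideal.Quotient.mk J) (φ.map_op f b)).trans h2)

/-! ### Rings of smooth functions -/

/-- The `C^∞`-ring `C^∞(V, ℝ)`, with pointwise operations. -/
def smooth (V : Type) [NormedAddCommGroup V] [NormedSpace ℝ V] : CInfRing where
  carrier := SmoothFn V
  op g f := g.comp f
  op_proj _ _ := rfl
  op_comp _ _ _ := rfl

/-- Precomposition with a continuous linear map, as a morphism of `C^∞`-rings. -/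
def smoothPull {V W : Type} [NormedAddCommGroup V] [NormedSpace ℝ V]
    [NormedAddCommGroup W] [NormedSpace ℝ W] (L : V →L[ℝ] W) : smooth W ⟶ smooth V where
  toFun := SmoothFn.pull L
  map_op _ _ := rfl

end CInfRing

/-! ## The cosimplicial `C^∞`-ring of infinitesimal linear simplices -/

open CInfRing

/-- `(ℝ^n)^{m+1}`, the space of linear `m`-simplices `(x_0, …, x_m)` in `ℝ^n`. -/
abbrev Simplices (n m : ℕ) : Type := Fin (m + 1) → Fin n → ℝ

/-- The product `π_i π_j` of two coordinate functions on `ℝ^n`. -/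
def coordMul {n : ℕ} (i j : Fin n) : SmoothFn (Fin n → ℝ) := ⟨fun x => x i * x j, by fun_prop⟩

/-- The ideal `I_n` of `C^∞(ℝ^n)` generated by the products `π_i π_j`. -/
def idealI (n : ℕ) : Ideal (smooth (Fin n → ℝ)) :=
  Ideal.span (Set.range fun p : Fin n × Fin n => coordMul p.1 p.2)

/-- The map `π_k - π_l : (ℝ^n)^{m+1} → ℝ^n`. -/
def diffMap (n m : ℕ) (k l : Fin (m + 1)) : Simplices n m →L[ℝ] (Fin n → ℝ) :=
  ContinuousLinearMap.proj (R := ℝ) (φ := fun _ : Fin (m + 1) => Fin n → ℝ) k -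
    ContinuousLinearMap.proj (R := ℝ) (φ := fun _ : Fin (m + 1) => Fin n → ℝ) l

/-- The ideal `∑_{k,l} I_n ∘ (π_k - π_l)` of `C^∞((ℝ^n)^{m+1})`. -/
def infIdeal (n m : ℕ) : Ideal (smooth (Simplices n m)) :=
  ⨆ k, ⨆ l, (idealI n).map (Hom.toRingHom (smoothPull (diffMap n m k l)))

/-- For a map `θ : [m] → [m']`, the map `(ℝ^n)^{m'+1} → (ℝ^n)^{m+1}`, `x ↦ x ∘ θ`. -/
def reindex (n : ℕ) {m m' : ℕ} (θ : Fin (m + 1) → Fin (m' + 1)) :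
    Simplices n m' →L[ℝ] Simplices n m :=
  ContinuousLinearMap.pi fun i => ContinuousLinearMap.proj (θ i)

theorem infIdeal_le_comap (n : ℕ) {m m' : ℕ} (θ : Fin (m + 1) → Fin (m' + 1)) :
    infIdeal n m ≤ (infIdeal n m').comap (Hom.toRingHom (smoothPull (reindex n θ))) := by
  refine iSup_le fun k => iSup_le fun l => Ideal.map_le_iff_le_comap.2 fun f hf => ?_
  have key := (le_iSup_of_le (θ k) (le_iSup_of_le (θ l) le_rfl) :
    (idealI n).map (Hom.toRingHom (smoothPull (diffMap n m' (θ k) (θ l)))) ≤ infIdeal n m')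
  exact key (Ideal.mem_map_of_mem (Hom.toRingHom (smoothPull (diffMap n m' (θ k) (θ l)))) hf)

/-- The cosimplicial `C^∞`-ring `Inf_n`. In degree `m` it is the quotient of `C^∞((ℝ^n)^{m+1})`
(the free `C^∞`-ring on `[m] × {1, …, n}`) by `infIdeal n m`, and `θ : [m] → [m']` acts by
`f ↦ (x ↦ f (x ∘ θ))`, that is, by `π_k ↦ π_{θ k}`. -/
def Inf (n : ℕ) : CosimplicialObject CInfRing where
  obj k := (smooth (Simplices n k.len)).quotient (infIdeal n k.len)
  map θ := quotientMap _ _ (smoothPull (reindex n θ.toOrderHom))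
    (infIdeal_le_comap n θ.toOrderHom)
  map_id k := by
    refine Hom.ext (funext fun a => ?_)
    obtain ⟨f, rfl⟩ := Ideal.Quotient.mk_surjective a
    rfl
  map_comp θ θ' := by
    refine Hom.ext (funext fun a => ?_)
    obtain ⟨f, rfl⟩ := Ideal.Quotient.mk_surjective a
    rfl

/-- The underlying cosimplicial abelian group of `Inf_n`. -/
def InfAb (n : ℕ) : CosimplicialObject AddCommGrpCat.{0} :=
  ((CosimplicialObject.whiskering _ _).obj underlyingAb).obj (Inf n)

/-- The class in `(Inf_n)_m` of a smooth function on `(ℝ^n)^{m+1}`. -/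
def InfAb.mk (n m : ℕ) (f : SmoothFn (Simplices n m)) : (InfAb n).obj (.mk m) :=
  (quotientMk (smooth (Simplices n m)) (infIdeal n m)).toFun f

/-! ## Normalization of cosimplicial abelian groups -/

section Normalization

variable (X : CosimplicialObject AddCommGrpCat.{0})

/-- The subgroup of `X^m` generated by the images of all coface maps into `X^m` except `d^0`. -/
def cofaceSubgroup : ∀ m : ℕ, AddSubgroup (X.obj (.mk m))
  | 0 => ⊥
  | m + 1 => ⨆ i : Fin (m + 1), (X.δ i.succ).hom.range

theorem cofaceSubgroup_le (m : ℕ) :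
    cofaceSubgroup X m ≤ (cofaceSubgroup X (m + 1)).comap (X.δ (0 : Fin (m + 2))).hom := by
  cases m with
  | zero => exact bot_le
  | succ m =>
    refine iSup_le fun i => ?_
    rintro _ ⟨a, rfl⟩
    have h := X.δ_comp_δ (i := 0) (j := i.succ) (Fin.zero_le _)
    have h' := ConcreteCategory.congr_hom h a
    refine (le_iSup (fun j : Fin (m + 2) => (X.δ j.succ).hom.range) i.succ) ?_
    exact ⟨_, h'⟩

/-- The differential `X^m / ∑_{i ≥ 1} im d^i → X^{m+1} / ∑_{i ≥ 1} im d^i` induced by `d^0`. -/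
def normalizedD (m : ℕ) :
    AddCommGrpCat.of (X.obj (.mk m) ⧸ cofaceSubgroup X m) ⟶
      AddCommGrpCat.of (X.obj (.mk (m + 1)) ⧸ cofaceSubgroup X (m + 1)) :=
  AddCommGrpCat.ofHom (QuotientAddGroup.map _ _ (X.δ (0 : Fin (m + 2))).hom
    (cofaceSubgroup_le X m))

theorem normalizedD_comp (m : ℕ) : normalizedD X m ≫ normalizedD X (m + 1) = 0 := by
  refine AddCommGrpCat.hom_ext (AddMonoidHom.ext fun b => ?_)
  obtain ⟨a, rfl⟩ := QuotientAddGroup.mk_surjective b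
  have h := X.δ_comp_δ (i := (0 : Fin (m + 2))) (j := 0) le_rfl
  have h' := ConcreteCategory.congr_hom h a
  refine (QuotientAddGroup.eq_zero_iff _).2 ?_
  refine (le_iSup (fun j : Fin (m + 2) => (X.δ j.succ).hom.range) 0) ?_
  exact ⟨_, h'⟩

/-- The normalized cochain complex of a cosimplicial abelian group. -/
def normalizedComplex : CochainComplex AddCommGrpCat.{0} ℕ :=
  CochainComplex.of (fun m => AddCommGrpCat.of (X.obj (.mk m) ⧸ cofaceSubgroup X m))
    (normalizedD X) (normalizedD_comp X)

/-- The quotient map from `X^m` to the degree `m` part of the normalized cochain complex. -/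
def toNormalized (m : ℕ) : X.obj (.mk m) ⟶ (normalizedComplex X).X m :=
  AddCommGrpCat.ofHom (QuotientAddGroup.mk' (cofaceSubgroup X m))

end Normalization

/-! ## The de Rham complex of `ℝ^n` -/

/-- The group of smooth differential `m`-forms on `ℝ^n`. -/
def DiffForm (n m : ℕ) : AddSubgroup ((Fin n → ℝ) → (Fin n → ℝ) [⋀^Fin m]→L[ℝ] ℝ) where
  carrier := {η | ContDiff ℝ ∞ η}
  zero_mem' := (contDiff_const : ContDiff ℝ ∞ fun _ => (0 : (Fin n → ℝ) [⋀^Fin m]→L[ℝ] ℝ))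
  add_mem' h h' := ContDiff.add (𝕜 := ℝ) (n := ∞) h h'
  neg_mem' h := ContDiff.neg (𝕜 := ℝ) (n := ∞) h

theorem DiffForm.smooth {n m : ℕ} (η : DiffForm n m) : ContDiff ℝ ∞ η.1 := η.2

theorem contDiff_extDeriv {n m : ℕ} {η : (Fin n → ℝ) → (Fin n → ℝ) [⋀^Fin m]→L[ℝ] ℝ}
    (h : ContDiff ℝ ∞ η) : ContDiff ℝ ∞ (extDeriv η) := by
  have h1 : ContDiff ℝ ∞ (fderiv ℝ η) := h.fderiv_right (m := ∞) (by simp)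
  exact (ContinuousAlternatingMap.alternatizeUncurryFinCLM ℝ (Fin n → ℝ) ℝ).contDiff.comp h1

/-- The exterior derivative on smooth differential forms. -/
def deRhamD (n m : ℕ) : DiffForm n m →+ DiffForm n (m + 1) where
  toFun η := ⟨extDeriv η.1, contDiff_extDeriv η.2⟩
  map_zero' := by
    refine Subtype.ext (funext fun x => ?_)
    have := extDeriv_smul (x := x) (0 : ℝ) (0 : (Fin n → ℝ) → (Fin n → ℝ) [⋀^Fin m]→L[ℝ] ℝ)
    simpa using this
  map_add' η ξ := Subtype.ext (funext fun x =>
    extDeriv_add ((DiffForm.smooth η).differentiable (by simp) x) ((DiffForm.smooth ξ).differentiable (by simp) x))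

/-- The de Rham complex of `ℝ^n`. -/
def deRham (n : ℕ) : CochainComplex AddCommGrpCat.{0} ℕ :=
  CochainComplex.of (fun m => AddCommGrpCat.of (DiffForm n m))
    (fun m => AddCommGrpCat.ofHom (deRhamD n m)) (fun m => by
      refine AddCommGrpCat.hom_ext (AddMonoidHom.ext fun η => Subtype.ext ?_)
      exact extDeriv_extDeriv (DiffForm.smooth η) (by
        rw [minSmoothness_of_isRCLikeNormedField]; exact WithTop.coe_le_coe.2 le_top))

/-! ## The form attached to a function on simplices -/

/-- The constant form `dx_{α 0} ∧ … ∧ dx_{α (m-1)}`, with value `det (v_i)_{α j}` on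
`(v_0, …, v_{m-1})`. -/
def dx {n m : ℕ} (α : Fin m → Fin n) : (Fin n → ℝ) [⋀^Fin m]→L[ℝ] ℝ :=
  { Matrix.detRowAlternating.compLinearMap (LinearMap.funLeft ℝ ℝ α) with
    cont := Continuous.matrix_det (continuous_pi fun i => continuous_pi fun j =>
      (continuous_apply (α j)).comp (continuous_apply i)) }

theorem dx_apply {n m : ℕ} (α : Fin m → Fin n) (v : Fin m → Fin n → ℝ) :
    dx α v = Matrix.det (Matrix.of fun i j => v i (α j)) := rfl

/-- The vector `e_{i,j}` of `(ℝ^n)^{m+1}` in the direction of the `j`-th coordinate of the `i`-th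
vertex. -/
def basisVec {n m : ℕ} (i : Fin (m + 1)) (j : Fin n) : Simplices n m :=
  Pi.single i (Pi.single j 1)

/-- The mixed partial derivative `∂^m f / ∂x_{1,α(1)} ⋯ ∂x_{m,α(m)}` at the degenerate simplex
`(x, …, x)`, where `f` is a function of `(x_0, …, x_m)`. -/
def mixedPartial {n m : ℕ} (f : SmoothFn (Simplices n m)) (α : Fin m → Fin n)
    (x : Fin n → ℝ) : ℝ :=
  iteratedFDeriv ℝ m f.1 (fun _ => x) (fun i => basisVec i.succ (α i))

theorem contDiff_mixedPartial {n m : ℕ} (f : SmoothFn (Simplices n m)) (α : Fin m → Fin n) :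
    ContDiff ℝ ∞ (mixedPartial f α) := by
  have h : ContDiff ℝ ∞ (iteratedFDeriv ℝ m f.1) :=
    f.2.iteratedFDeriv_right (m := ∞) (by exact_mod_cast le_top)
  have h' : ContDiff ℝ ∞ (fun x : Fin n → ℝ => iteratedFDeriv ℝ m f.1 (fun _ => x)) :=
    h.comp (contDiff_pi.2 fun _ => contDiff_id)
  exact (ContinuousMultilinearMap.apply ℝ (fun _ : Fin m => Simplices n m) ℝ
    (fun i => basisVec i.succ (α i))).contDiff.comp h'

/-- The `m`-form `∑_α (∂^m f / ∂x_{1,α(1)} ⋯ ∂x_{m,α(m)})(x, …, x) dx_{α(1)} ∧ … ∧ dx_{α(m)}`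
on `ℝ^n`, the sum over all injections `α : {1, …, m} → {1, …, n}`. -/
def simplexForm {n m : ℕ} (f : SmoothFn (Simplices n m)) : DiffForm n m :=
  ⟨fun x => ∑ α : Fin m ↪ Fin n, mixedPartial f α x • dx α,
    ContDiff.sum (𝕜 := ℝ) (n := ∞) fun (α : Fin m ↪ Fin n) _ =>
      ContDiff.smul (g := fun _ => dx α) (contDiff_mixedPartial f α) contDiff_const⟩

end CInf

end

/-! Put `y_i = x_i - x_0`. Modulo `infIdeal` a product of two coordinates of the same `y_i` is zero,
and since a product of two coordinates of `y_i - y_j` is zero as well, polarization shows that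
`y_{i,a} y_{j,b}` changes sign when `a` and `b` are exchanged. A Taylor expansion at `x_0` in each
vertex `x_i`, `i ≥ 1`, therefore stops after the linear term. A term that does not involve some
`x_i` with `i ≥ 1` lies in the image of `d^i`. So the normalized group in degree `m` is generated by
the monomials `c(x_0) ∏ y_{i,α(i)}`, which are alternating in `α`: these are the forms `c dx_α`.

Three facts turn this into a proof. The form of a function vanishes on `infIdeal` and on the images
of the cofaces `d^i`, `i ≥ 1` (`formHom_eq_zero_of_mem`, `degenerate_le_ker`). Every function is a
sum of monomials and a degenerate function (`closure_monomial_sup_degenerate`), by Hadamard's lemma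
applied vertex by vertex. The map `η ↦ η(x_0)(y_1, …, y_m) / m!` is a right inverse of `formHom`,
and a left inverse modulo degenerate functions, which is checked on monomials. Hence the kernel of
`formHom` is exactly `degenerate`.

Compatibility with the differentials also needs checking only on monomials. There `d^0` moves the
base point from `x_0` to `x_1`, so the derivative in `x_1` falls on `c`, and expanding a determinant
along its first column gives `dc ∧ dx_α`. -/

noncomputable section

namespace CInf

open CategoryTheory CInfRing
open scoped ContDiff Topology

/-! ### Directional derivatives on rings of smooth functions -/

section Calculus

variable {V W : Type} [NormedAddCommGroup V] [NormedSpace ℝ V]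
  [NormedAddCommGroup W] [NormedSpace ℝ W]

/-- Evaluation at a point, as a ring homomorphism on the ring of smooth functions. -/
def ev (x : V) : smooth V →+* ℝ where
  toFun f := SmoothFn.toFun f x
  map_zero' := rfl
  map_one' := rfl
  map_add' _ _ := rfl
  map_mul' _ _ := rfl

theorem smooth_ext {f g : smooth V} (h : ∀ x, ev x f = ev x g) : f = g :=
  SmoothFn.ext (funext h)

/-- A smooth function, as an element of the ring of smooth functions. -/
def ofFn (f : V → ℝ) (hf : ContDiff ℝ ∞ f) : smooth V := SmoothFn.mk f hf

@[simp]
theorem ev_ofFn (f : V → ℝ) (hf : ContDiff ℝ ∞ f) (x : V) : ev x (ofFn f hf) = f x := rfl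

theorem contDiff_ev (f : smooth V) : ContDiff ℝ ∞ fun x => ev x f := SmoothFn.smooth f

theorem differentiableAt_ev (f : smooth V) (x : V) : DifferentiableAt ℝ (fun x => ev x f) x :=
  (contDiff_ev f).differentiable (by simp) x

/-- Pullback of smooth functions along a continuous linear map, as a ring homomorphism. -/
def pullHom (L : V →L[ℝ] W) : smooth W →+* smooth V := Hom.toRingHom (smoothPull L)

@[simp]
theorem ev_pullHom (L : V →L[ℝ] W) (f : smooth W) (x : V) : ev x (pullHom L f) = ev (L x) f := rfl

/-- The derivative of smooth functions in a fixed direction. -/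
def dirD (w : V) : smooth V →+ smooth V where
  toFun f := ofFn (fun x => fderiv ℝ (fun y => ev y f) x w)
    (((contDiff_ev f).fderiv_right (m := ∞) (by simp)).clm_apply contDiff_const)
  map_zero' := smooth_ext fun x => by simp
  map_add' f g := smooth_ext fun x => by
    simp only [map_add, ev_ofFn]
    rw [fderiv_fun_add (differentiableAt_ev f x) (differentiableAt_ev g x)]
    rfl

theorem ev_dirD (w : V) (f : smooth V) (x : V) :
    ev x (dirD w f) = fderiv ℝ (fun y => ev y f) x w := rfl

theorem dirD_mul (w : V) (f g : smooth V) :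
    dirD w (f * g) = dirD w f * g + f * dirD w g := smooth_ext fun x => by
  simp only [map_add, map_mul, ev_dirD]
  rw [fderiv_fun_mul (differentiableAt_ev f x) (differentiableAt_ev g x)]
  simp only [add_apply, smul_apply, smul_eq_mul]
  ring

theorem dirD_comm (v w : V) (f : smooth V) : dirD v (dirD w f) = dirD w (dirD v f) :=
  smooth_ext fun x => by
    have h1 : DifferentiableAt ℝ (fderiv ℝ fun y => ev y f) x :=
      ((contDiff_ev f).fderiv_right (m := ∞) (by simp)).differentiable (by simp) x
    have h2 : ∀ a b : V, ev x (dirD a (dirD b f)) =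
        fderiv ℝ (fderiv ℝ fun y => ev y f) x a b := fun a b => by
      rw [ev_dirD]
      simp only [ev_dirD]
      rw [fderiv_clm_apply h1 (differentiableAt_const b)]
      simp
    rw [h2, h2]
    exact ((contDiff_ev f).contDiffAt.isSymmSndFDerivAt (by
      rw [minSmoothness_of_isRCLikeNormedField]; exact WithTop.coe_le_coe.2 le_top)) v w

theorem dirD_pullHom (L : V →L[ℝ] W) (w : V) (f : smooth W) :
    dirD w (pullHom L f) = pullHom L (dirD (L w) f) := smooth_ext fun x => by
  rw [ev_dirD, ev_pullHom, ev_dirD]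
  exact congrArg (· w) (((differentiableAt_ev f (L x)).hasFDerivAt.comp x L.hasFDerivAt).fderiv)

/-- If `f` is invariant under translation by `z`, so are its directional derivatives. -/
theorem dirD_add_of_forall {f : smooth V} {z : V} (h : ∀ x, ev (x + z) f = ev x f) (w x : V) :
    ev (x + z) (dirD w f) = ev x (dirD w f) := by
  rw [ev_dirD, ev_dirD, ← fderiv_comp_add_right]
  simp only [h]

/-- A smooth function that does not change along the line spanned by `w` has derivative zero in the
direction `w`. -/
theorem dirD_eq_zero {f : smooth V} {w : V} (h : ∀ x (t : ℝ), ev (x + t • w) f = ev x f) :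
    dirD w f = 0 := smooth_ext fun x => by
  rw [ev_dirD, ← (differentiableAt_ev f x).lineDeriv_eq_fderiv, lineDeriv]
  simp [h]

/-- If `f` vanishes on a submodule, so do its derivatives in the directions of this submodule. -/
theorem dirD_vanish (H : Submodule ℝ V) {f : smooth V} (h : ∀ x ∈ H, ev x f = 0) {w : V}
    (hw : w ∈ H) (x : V) (hx : x ∈ H) : ev x (dirD w f) = 0 := by
  rw [ev_dirD, ← (differentiableAt_ev f x).lineDeriv_eq_fderiv, lineDeriv]
  have : (fun t : ℝ => ev (x + t • w) f) = fun _ => 0 :=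
    funext fun t => h _ (H.add_mem hx (H.smul_mem t hw))
  rw [this]
  simp

/-- Commutation of derivatives allows folding over a multiset, so that the iterated derivative below
is indexed by a finite set and any chosen direction can be taken first or last. -/
instance : LeftCommutative fun (w : V) (f : smooth V) => dirD w f := ⟨dirD_comm⟩

variable {ι : Type}

/-- The iterated derivative of a smooth function in the directions `w i`, `i ∈ S`. -/
def iterD (S : Finset ι) (w : ι → V) (f : smooth V) : smooth V :=
  (S.val.map w).foldr (fun w f => dirD w f) f

@[simp]
theorem iterD_empty (w : ι → V) (f : smooth V) : iterD ∅ w f = f := rfl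

theorem iterD_insert [DecidableEq ι] {S : Finset ι} {i : ι} (h : i ∉ S) (w : ι → V)
    (f : smooth V) : iterD (insert i S) w f = dirD (w i) (iterD S w f) := by
  rw [iterD, Finset.insert_val_of_notMem h, Multiset.map_cons, Multiset.foldr_cons]
  rfl

theorem dirD_iterD (S : Finset ι) (w : ι → V) (v : V) (f : smooth V) :
    dirD v (iterD S w f) = iterD S w (dirD v f) := by
  classical
  induction S using Finset.induction_on with
  | empty => rfl
  | insert i S hi ih => rw [iterD_insert hi, iterD_insert hi, dirD_comm, ih]

theorem iterD_congr {S : Finset ι} {w w' : ι → V} (h : ∀ i ∈ S, w i = w' i) (f : smooth V) :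
    iterD S w f = iterD S w' f := by
  rw [iterD, iterD, Multiset.map_congr rfl h]

theorem iterD_add (S : Finset ι) (w : ι → V) (f g : smooth V) :
    iterD S w (f + g) = iterD S w f + iterD S w g := by
  classical
  induction S using Finset.induction_on with
  | empty => rfl
  | insert i S hi ih => rw [iterD_insert hi, iterD_insert hi, iterD_insert hi, ih, map_add]

theorem iterD_sub (S : Finset ι) (w : ι → V) (f g : smooth V) :
    iterD S w (f - g) = iterD S w f - iterD S w g := by
  rw [eq_sub_iff_add_eq, ← iterD_add, sub_add_cancel]

theorem iterD_zero (S : Finset ι) (w : ι → V) : iterD S w (0 : smooth V) = 0 := by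
  classical
  induction S using Finset.induction_on with
  | empty => rfl
  | insert i S hi ih => rw [iterD_insert hi, ih, map_zero]

theorem iterD_pullHom (L : V →L[ℝ] W) (S : Finset ι) (w : ι → V) (f : smooth W) :
    iterD S w (pullHom L f) = pullHom L (iterD S (fun i => L (w i)) f) := by
  classical
  induction S using Finset.induction_on with
  | empty => rfl
  | insert i S hi ih => rw [iterD_insert hi, iterD_insert hi, ih, dirD_pullHom]

theorem iterD_vanish (H : Submodule ℝ V) {f : smooth V} (h : ∀ x ∈ H, ev x f = 0)
    (S : Finset ι) {w : ι → V} (hw : ∀ i ∈ S, w i ∈ H) : ∀ x ∈ H, ev x (iterD S w f) = 0 := by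
  classical
  induction S using Finset.induction_on with
  | empty => exact h
  | insert i S hi ih =>
    rw [iterD_insert hi]
    exact dirD_vanish H (ih fun j hj => hw j (Finset.mem_insert_of_mem hj))
      (hw i (Finset.mem_insert_self i S))

theorem iteratedFDeriv_eq_foldr (f : smooth V) (m : ℕ) (w : Fin m → V) (x : V) :
    iteratedFDeriv ℝ m (fun y => ev y f) x w =
      ev x ((List.ofFn w).foldr (fun w f => dirD w f) f) := by
  induction m generalizing x with
  | zero => simp
  | succ m ih =>
    have h : DifferentiableAt ℝ (iteratedFDeriv ℝ m fun y => ev y f) x :=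
      ((contDiff_ev f).iteratedFDeriv_right (m := ∞) (i := m)
        (by exact_mod_cast le_top)).differentiable (by simp) x
    rw [iteratedFDeriv_succ_apply_left, List.ofFn_succ, List.foldr_cons, ev_dirD]
    simp only [← ih]
    rw [fderiv_continuousMultilinear_apply_const_apply h]
    rfl

theorem iteratedFDeriv_eq_iterD (f : smooth V) {m : ℕ} (w : Fin m → V) (x : V) :
    iteratedFDeriv ℝ m (fun y => ev y f) x w = ev x (iterD Finset.univ w f) := by
  rw [iteratedFDeriv_eq_foldr, iterD, Fin.univ_val_map, Multiset.coe_foldr]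

end Calculus

theorem mixedPartial_eq {n m : ℕ} (f : smooth (Simplices n m)) (α : Fin m → Fin n)
    (x : Fin n → ℝ) : mixedPartial f α x =
      ev (fun _ => x) (iterD Finset.univ (fun i : Fin m => basisVec i.succ (α i)) f) :=
  iteratedFDeriv_eq_iterD f _ _

variable {n m : ℕ}

/-! ### The forms `dx α` -/

theorem dx_eq_zero {α : Fin m → Fin n} (h : ¬ Function.Injective α) : dx α = 0 := by
  simp only [Function.Injective, not_forall] at h
  obtain ⟨i, j, hij, hne⟩ := h
  ext v
  rw [dx_apply]
  exact Matrix.det_zero_of_column_eq hne fun k => by simp [hij]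

theorem dx_comp_perm (α : Fin m → Fin n) (σ : Equiv.Perm (Fin m)) :
    dx (α ∘ σ) = ((Equiv.Perm.sign σ : ℤ) : ℝ) • dx α := by
  ext v
  rw [ContinuousAlternatingMap.smul_apply, dx_apply, dx_apply, smul_eq_mul]
  exact Matrix.det_permute' σ (Matrix.of fun i j => v i (α j))

/-- Symmetric coefficients are paired with forms that are antisymmetric in `k` and `l`: reindexing
by the transposition turns the sum into its negative. -/
theorem sum_smul_dx_eq_zero {c : (Fin m → Fin n) → ℝ} {k l : Fin m} (hkl : k ≠ l)
    (h : ∀ α, c (α ∘ Equiv.swap k l) = c α) : ∑ α, c α • dx α = 0 := by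
  have h1 : ∑ α, c α • dx α = ∑ α : Fin m → Fin n, -(c α • dx α) := by
    rw [← Equiv.sum_comp (Equiv.arrowCongr (Equiv.swap k l) (Equiv.refl (Fin n)))]
    refine Finset.sum_congr rfl fun α _ => ?_
    have : Equiv.arrowCongr (Equiv.swap k l) (Equiv.refl (Fin n)) α = α ∘ Equiv.swap k l := by
      ext i; simp
    rw [this, h, dx_comp_perm, Equiv.Perm.sign_swap hkl]
    rw [Units.val_neg, Units.val_one, Int.cast_neg, Int.cast_one]
    module
  rw [Finset.sum_neg_distrib, eq_neg_iff_add_eq_zero, ← two_smul ℝ] at h1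
  exact (smul_eq_zero.1 h1).resolve_left two_ne_zero

/-! ### The form of a function on simplices -/

/-- The mixed partial derivative `∂^m f / ∂x_{1,α(1)} ⋯ ∂x_{m,α(m)}` at `(x, …, x)`. -/
def partialAt (f : smooth (Simplices n m)) (α : Fin m → Fin n) (x : Fin n → ℝ) : ℝ :=
  ev (fun _ => x) (iterD Finset.univ (fun i : Fin m => basisVec i.succ (α i)) f)

/-- Non-injective `α` contribute nothing, because `dx α` then has two equal columns. Summing over
all maps makes reindexing free of injectivity conditions. -/
theorem simplexForm_apply (f : smooth (Simplices n m)) (x : Fin n → ℝ) :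
    (simplexForm f).1 x = ∑ α : Fin m → Fin n, partialAt f α x • dx α := by
  refine Finset.sum_of_injOn (fun α : Fin m ↪ Fin n => (α : Fin m → Fin n))
    (DFunLike.coe_injective.injOn) (by simp) (fun α _ hα => ?_)
    (fun α _ => congrArg (· • dx α) (mixedPartial_eq f α x))
  rw [dx_eq_zero, smul_zero]
  intro h
  exact hα ⟨⟨α, h⟩, by simp, rfl⟩

/-- The form of a function on simplices, as a homomorphism of groups. -/
def formHom (n m : ℕ) : smooth (Simplices n m) →+ DiffForm n m where
  toFun f := simplexForm f
  map_zero' := Subtype.ext (funext fun x => (simplexForm_apply 0 x).trans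
    (Finset.sum_eq_zero fun α _ => by rw [partialAt, iterD_zero, map_zero, zero_smul]))
  map_add' f g := Subtype.ext (funext fun x => by
    refine (simplexForm_apply (f + g) x).trans (Eq.trans ?_
      (congrArg₂ (· + ·) (simplexForm_apply f x) (simplexForm_apply g x)).symm)
    rw [← Finset.sum_add_distrib]
    refine Finset.sum_congr rfl fun α _ => ?_
    rw [partialAt, partialAt, partialAt, iterD_add, map_add, add_smul])

theorem formHom_apply (f : smooth (Simplices n m)) (x : Fin n → ℝ) :
    (formHom n m f).1 x = ∑ α : Fin m → Fin n, partialAt f α x • dx α := simplexForm_apply f x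

theorem formHom_eq_zero {f : smooth (Simplices n m)} (h : ∀ α x, partialAt f α x = 0) :
    formHom n m f = 0 := by
  refine Subtype.ext (funext fun x => ?_)
  rw [formHom_apply]
  exact Finset.sum_eq_zero fun α _ => by rw [h, zero_smul]

/-! ### Edge functions, and vanishing of the form on the ideal -/

/-- The function `x ↦ x_{k,a} - x_{l,a}` on simplices. -/
def edge (k l : Fin (m + 1)) (a : Fin n) : smooth (Simplices n m) :=
  ofFn (fun x => x k a - x l a) (by fun_prop)

theorem ev_edge (k l : Fin (m + 1)) (a : Fin n) (x : Simplices n m) :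
    ev x (edge k l a) = x k a - x l a := rfl

theorem ev_dirD_edge (k l : Fin (m + 1)) (a : Fin n) (w x : Simplices n m) :
    ev x (dirD w (edge k l a)) = w k a - w l a := by
  let L : Simplices n m →L[ℝ] ℝ :=
    (ContinuousLinearMap.proj (R := ℝ) (φ := fun _ : Fin n => ℝ) a).comp (diffMap n m k l)
  exact congrArg (· w) (L.fderiv (x := x))

theorem edge_mem (k l : Fin (m + 1)) (a b : Fin n) :
    edge k l a * edge k l b ∈ infIdeal n m := by
  have h : (idealI n).map (Hom.toRingHom (smoothPull (diffMap n m k l))) ≤ infIdeal n m :=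
    le_iSup_of_le k (le_iSup_of_le l le_rfl)
  exact h (Ideal.mem_map_of_mem (Hom.toRingHom (smoothPull (diffMap n m k l)))
    (Ideal.subset_span ⟨(a, b), rfl⟩ : coordMul a b ∈ idealI n))

theorem infIdeal_le {N : Ideal (smooth (Simplices n m))}
    (h : ∀ k l a b, edge k l a * edge k l b ∈ N) : infIdeal n m ≤ N := by
  refine iSup_le fun k => iSup_le fun l => Ideal.map_le_iff_le_comap.2 (Ideal.span_le.2 ?_)
  rintro _ ⟨⟨a, b⟩, rfl⟩
  exact h k l a b

theorem insert_erase_univ {ι : Type} [Fintype ι] [DecidableEq ι] (p : ι) :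
    insert p (Finset.univ.erase p) = Finset.univ := Finset.insert_erase (Finset.mem_univ p)

theorem iterD_univ_erase {V ι : Type} [NormedAddCommGroup V] [NormedSpace ℝ V] [Fintype ι]
    [DecidableEq ι] (p : ι) (w : ι → V) (f : smooth V) :
    iterD Finset.univ w f = iterD (Finset.univ.erase p) w (dirD (w p) f) := by
  rw [← dirD_iterD, ← iterD_insert (Finset.notMem_erase p _), insert_erase_univ]

theorem basisVec_of_ne {i k : Fin (m + 1)} (h : k ≠ i) (a : Fin n) :
    basisVec i a k = 0 := by
  simp [basisVec, h]

/-- The subspace of simplices whose vertices `k` and `l` agree. -/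
def diagonal (n : ℕ) {m : ℕ} (k l : Fin (m + 1)) : Submodule ℝ (Simplices n m) :=
  LinearMap.ker (diffMap n m k l).toLinearMap

theorem mem_diagonal {k l : Fin (m + 1)} {x : Simplices n m} :
    x ∈ diagonal n k l ↔ x k = x l := sub_eq_zero

theorem ev_edge_of_mem {k l : Fin (m + 1)} {x : Simplices n m} (hx : x ∈ diagonal n k l)
    (a : Fin n) : ev x (edge k l a) = 0 := by
  rw [ev_edge, mem_diagonal.1 hx, sub_self]

theorem dirD_mul_edge_mul_edge {k l : Fin (m + 1)} (h : smooth (Simplices n m)) (a b : Fin n)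
    (w : Simplices n m) {x : Simplices n m} (hx : x ∈ diagonal n k l) :
    ev x (dirD w (h * (edge k l a * edge k l b))) = 0 := by
  simp only [dirD_mul, map_add, map_mul, ev_edge_of_mem hx]
  ring

/-- Both edge factors vanish on the diagonal, so only the Leibniz terms survive in which each of
them is differentiated once. -/
theorem dirD_dirD_mul_edge_mul_edge {k l : Fin (m + 1)} (h : smooth (Simplices n m)) (a b : Fin n)
    (u w : Simplices n m) {x : Simplices n m} (hx : x ∈ diagonal n k l) :
    ev x (dirD u (dirD w (h * (edge k l a * edge k l b)))) = ev x h *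
      ((u k a - u l a) * (w k b - w l b) + (w k a - w l a) * (u k b - u l b)) := by
  simp only [dirD_mul, map_add, map_mul, ev_edge_of_mem hx, ev_dirD_edge]
  ring

/-- At most one of the directions, that at `p`, moves vertex `k` or `l`. After this single
derivative the function still vanishes on the diagonal `x_k = x_l`, and all other directions are
tangent to the diagonal. -/
theorem partialAt_eq_zero_of_vertex (h : smooth (Simplices n m)) (k l : Fin (m + 1))
    (a b : Fin n) (p : Fin m) (hp : ∀ i, i ≠ p → i.succ ≠ k ∧ i.succ ≠ l) (α : Fin m → Fin n)
    (x : Fin n → ℝ) : partialAt (h * (edge k l a * edge k l b)) α x = 0 := by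
  rw [partialAt, iterD_univ_erase p]
  refine iterD_vanish (diagonal n k l) (fun x hx => dirD_mul_edge_mul_edge h a b _ hx) _
    (fun i hi => ?_) _ (mem_diagonal.2 rfl)
  obtain ⟨h1, h2⟩ := hp i (Finset.ne_of_mem_erase hi)
  rw [mem_diagonal, basisVec_of_ne h1.symm, basisVec_of_ne h2.symm]

/-- Take the derivatives at `k` and `l` first. By `dirD_dirD_mul_edge_mul_edge` the result on the
diagonal `x_k = x_l` is symmetric in `α k` and `α l`, and the remaining directions are tangent to
that diagonal, so they preserve the equality. -/
theorem partialAt_comp_swap (h : smooth (Simplices n m)) (a b : Fin n) {k l : Fin m}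
    (hkl : k ≠ l) (α : Fin m → Fin n) (x : Fin n → ℝ) :
    partialAt (h * (edge k.succ l.succ a * edge k.succ l.succ b))
      (α ∘ Equiv.swap k l) x =
    partialAt (h * (edge k.succ l.succ a * edge k.succ l.succ b)) α x := by
  set q := h * (edge k.succ l.succ a * edge k.succ l.succ b)
  have key : ∀ β : Fin m → Fin n, partialAt q β x = ev (fun _ => x)
      (iterD ((Finset.univ.erase k).erase l) (fun i : Fin m => basisVec i.succ (β i))
        (dirD (basisVec l.succ (β l)) (dirD (basisVec k.succ (β k)) q))) := fun β => by
    rw [partialAt, iterD_univ_erase k, ← dirD_iterD _ _ (basisVec l.succ (β l)),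
      ← iterD_insert (w := fun i : Fin m => basisVec i.succ (β i)) (Finset.notMem_erase l _),
      Finset.insert_erase (Finset.mem_erase.2 ⟨hkl.symm, Finset.mem_univ l⟩)]
  rw [key, key, iterD_congr (w' := fun i : Fin m => basisVec i.succ (α i)), ← sub_eq_zero,
    ← map_sub, ← iterD_sub]
  · refine iterD_vanish (diagonal n k.succ l.succ) (fun x hx => ?_) _ (fun i hi => ?_) _
      (mem_diagonal.2 rfl)
    · have hkl' : k.succ ≠ l.succ := fun e => hkl (Fin.succ_injective _ e)
      rw [map_sub, dirD_dirD_mul_edge_mul_edge h a b _ _ hx,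
        dirD_dirD_mul_edge_mul_edge h a b _ _ hx]
      simp only [basisVec_of_ne hkl', basisVec_of_ne hkl'.symm, Function.comp_apply,
        Equiv.swap_apply_left, Equiv.swap_apply_right, Pi.zero_apply]
      simp only [basisVec, Pi.single_eq_same]
      ring
    · simp only [Finset.mem_erase] at hi
      rw [mem_diagonal, basisVec_of_ne, basisVec_of_ne]
      · exact fun e => hi.1 (Fin.succ_injective _ e).symm
      · exact fun e => hi.2.1 (Fin.succ_injective _ e).symm
  · intro i hi
    simp only [Finset.mem_erase] at hi
    rw [Function.comp_apply, Equiv.swap_apply_of_ne_of_ne hi.2.1 hi.1]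

/-- If one of the vertices is `x_0`, which is never differentiated, every mixed partial vanishes. If
both are positive, the partials need not vanish, but they are symmetric in two indices and cancel
against the alternating `dx α`. -/
theorem formHom_mul_edge_mul_edge (h : smooth (Simplices n m)) (k l : Fin (m + 1))
    (a b : Fin n) : formHom n m (h * (edge k l a * edge k l b)) = 0 := by
  by_cases hkl : k = l
  · subst hkl
    have : edge k k a = (0 : smooth (Simplices n m)) := smooth_ext fun x => by simp [ev_edge]
    rw [this, zero_mul, mul_zero, map_zero]
  rcases Fin.eq_zero_or_eq_succ k with rfl | ⟨k, rfl⟩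
  · obtain ⟨l, rfl⟩ := Fin.exists_succ_eq.2 (Ne.symm hkl)
    exact CInf.formHom_eq_zero (partialAt_eq_zero_of_vertex h _ _ a b l fun i hi =>
      ⟨Fin.succ_ne_zero i, fun e => hi (Fin.succ_injective _ e)⟩)
  rcases Fin.eq_zero_or_eq_succ l with rfl | ⟨l, rfl⟩
  · exact CInf.formHom_eq_zero (partialAt_eq_zero_of_vertex h _ _ a b k fun i hi =>
      ⟨fun e => hi (Fin.succ_injective _ e), Fin.succ_ne_zero i⟩)
  have hkl' : k ≠ l := fun e => hkl (congrArg _ e)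
  refine Subtype.ext (funext fun x => ?_)
  exact (formHom_apply _ x).trans
    (sum_smul_dx_eq_zero hkl' fun α => partialAt_comp_swap h a b hkl' α x)

theorem formHom_eq_zero_of_mem {f : smooth (Simplices n m)} (hf : f ∈ infIdeal n m) :
    formHom n m f = 0 := by
  -- The kernel of `formHom` is not known to be an ideal; `N` is the largest ideal contained in it,
  -- and it suffices that `N` contains the generators.
  let N : Ideal (smooth (Simplices n m)) :=
    { carrier := {f | ∀ h, formHom n m (h * f) = 0}
      zero_mem' := fun h => by rw [mul_zero, map_zero]
      add_mem' := fun {f g} hf hg h => by rw [mul_add, map_add, hf, hg, add_zero]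
      smul_mem' := fun c f hf h => by rw [smul_eq_mul, ← mul_assoc, hf] }
  have : f ∈ N := infIdeal_le (N := N) (fun k l a b h => formHom_mul_edge_mul_edge h k l a b) hf
  rw [← one_mul f]
  exact this 1

/-! ### Functions independent of some vertices, and cofaces -/

/-- `f` does not depend on the vertices in `S`. -/
def Indep (S : Finset (Fin (m + 1))) (f : smooth (Simplices n m)) : Prop :=
  ∀ z : Simplices n m, (∀ k ∉ S, z k = 0) → ∀ x, ev (x + z) f = ev x f

theorem Indep.dirD_eq_zero {S : Finset (Fin (m + 1))} {f : smooth (Simplices n m)}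
    (hf : Indep S f) {i : Fin (m + 1)} (hi : i ∈ S) (a : Fin n) :
    dirD (basisVec i a) f = 0 := by
  refine CInf.dirD_eq_zero fun x t => hf _ (fun k hk => ?_) x
  rw [Pi.smul_apply, basisVec_of_ne (fun e : k = i => hk (e.symm ▸ hi)), smul_zero]

theorem Indep.formHom_eq_zero {S : Finset (Fin (m + 1))} {f : smooth (Simplices n m)}
    (hf : Indep S f) {p : Fin m} (hp : p.succ ∈ S) : formHom n m f = 0 :=
  CInf.formHom_eq_zero fun α x => by
    rw [partialAt, iterD_univ_erase p, hf.dirD_eq_zero hp, iterD_zero, map_zero]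

theorem indep_pullHom_succAbove (i : Fin (m + 2)) (f : smooth (Simplices n m)) :
    Indep {i} (pullHom (reindex n i.succAbove) f) := by
  intro z hz x
  have : reindex n i.succAbove z = 0 :=
    funext fun k => hz _ fun h => Fin.succAbove_ne i k (Finset.mem_singleton.1 h)
  rw [ev_pullHom, ev_pullHom, map_add, this, add_zero]

theorem Indep.exists_eq_pullHom {p : Fin (m + 1)} {f : smooth (Simplices n (m + 1))}
    (hf : Indep {p.succ} f) : ∃ g, f = pullHom (reindex n p.succ.succAbove) g := by
  -- The preimage restricts `f` along a codegeneracy, which repeats a vertex. Dropping vertex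
  -- `p.succ` and then repeating its predecessor changes a simplex only at `p.succ`, where `f` is
  -- insensitive.
  refine ⟨pullHom (reindex n p.predAbove) f, smooth_ext fun x => ?_⟩
  rw [ev_pullHom, ev_pullHom]
  refine (Eq.trans ?_ (hf (reindex n p.predAbove (reindex n p.succ.succAbove x) - x) ?_ x)).symm
  · rw [add_sub_cancel]
  · intro k hk
    have : p.succ.succAbove (p.predAbove k) = k :=
      Fin.succ_succAbove_predAbove (fun h => hk (Finset.mem_singleton.2 h))
    exact sub_eq_zero.2 (congrArg x this)

/-! ### Monomial functions on simplices -/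

/-- The function `x ↦ c (x_0) ∏ (x_{i,α i} - x_{0,α i})` on simplices. -/
def monomial (α : Fin m → Fin n) (c : smooth (Fin n → ℝ)) : smooth (Simplices n m) :=
  (∏ i, edge i.succ 0 (α i)) * pullHom (ContinuousLinearMap.proj 0) c

theorem dirD_prod_eq_zero {V ι : Type} [NormedAddCommGroup V] [NormedSpace ℝ V] {w : V}
    {S : Finset ι} {f : ι → smooth V} (h : ∀ i ∈ S, dirD w (f i) = 0) :
    dirD w (∏ i ∈ S, f i) = 0 :=
  Finset.prod_induction f (fun g => dirD w g = 0)
    (fun f g hf hg => by rw [dirD_mul, hf, hg, zero_mul, mul_zero, add_zero])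
    (dirD_eq_zero fun x t => by rw [map_one, map_one]) h

theorem dirD_edge_self (p : Fin m) (a b : Fin n) :
    dirD (basisVec p.succ b) (edge p.succ 0 a) =
      if b = a then (1 : smooth (Simplices n m)) else 0 := by
  refine smooth_ext fun x => ?_
  rw [ev_dirD_edge, basisVec_of_ne (Fin.succ_ne_zero p).symm]
  simp only [basisVec, Pi.single_eq_same, Pi.zero_apply, sub_zero, Pi.single_apply, eq_comm]
  split_ifs <;> simp

theorem dirD_edge_of_ne {p i : Fin m} (h : i ≠ p) (a b : Fin n) :
    dirD (basisVec p.succ b) (edge i.succ 0 a) = (0 : smooth (Simplices n m)) := by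
  refine smooth_ext fun x => ?_
  rw [ev_dirD_edge, basisVec_of_ne (Fin.succ_ne_zero p).symm,
    basisVec_of_ne fun e => h (Fin.succ_injective _ e)]
  simp

/-- The derivative at vertex `i` can only hit the edge factor of that same vertex, and gives `1` or
`0` according to whether the coordinates match. -/
theorem iterD_prod_edge_mul (α β : Fin m → Fin n) (S : Finset (Fin m))
    (g : smooth (Simplices n m)) (hg : ∀ i a, dirD (basisVec (Fin.succ i) a) g = 0) :
    iterD S (fun i : Fin m => basisVec i.succ (β i)) ((∏ i ∈ S, edge i.succ 0 (α i)) * g) =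
      if ∀ i ∈ S, β i = α i then g else 0 := by
  induction S using Finset.induction_on with
  | empty => simp
  | insert p S hp ih =>
    have h0 : dirD (basisVec p.succ (β p)) (∏ i ∈ S, edge i.succ 0 (α i)) =
        (0 : smooth (Simplices n m)) :=
      dirD_prod_eq_zero fun i hi => dirD_edge_of_ne (fun e : i = p => hp (e ▸ hi)) _ _
    rw [iterD_insert hp, dirD_iterD, Finset.prod_insert hp, mul_assoc, dirD_mul, dirD_mul,
      h0, hg, dirD_edge_self, zero_mul, mul_zero, add_zero, mul_zero, add_zero, ite_mul, one_mul,
      zero_mul]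
    by_cases h : β p = α p
    · rw [if_pos h, ih]
      simp [h]
    · rw [if_neg h, iterD_zero, if_neg]
      exact fun h' => h (h' p (Finset.mem_insert_self p S))

theorem dirD_succ_pullHom_proj_zero (i : Fin m) (a : Fin n) (c : smooth (Fin n → ℝ)) :
    dirD (basisVec i.succ a) (pullHom (ContinuousLinearMap.proj 0) c) =
      (0 : smooth (Simplices n m)) := by
  have : (ContinuousLinearMap.proj 0 : Simplices n m →L[ℝ] Fin n → ℝ) (basisVec i.succ a) = 0 :=
    basisVec_of_ne (Fin.succ_ne_zero i).symm a
  rw [dirD_pullHom, this, dirD_eq_zero (fun x t => by simp), map_zero]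

theorem iterD_monomial (α β : Fin m → Fin n) (c : smooth (Fin n → ℝ)) :
    iterD Finset.univ (fun i : Fin m => basisVec i.succ (β i)) (monomial α c) =
      if β = α then pullHom (ContinuousLinearMap.proj 0) c else 0 := by
  rw [monomial, iterD_prod_edge_mul α β _ _ fun i a => dirD_succ_pullHom_proj_zero i a c]
  simp only [Finset.mem_univ, true_imp_iff, funext_iff]

theorem formHom_monomial_apply (α : Fin m → Fin n) (c : smooth (Fin n → ℝ)) (x : Fin n → ℝ) :
    (formHom n m (monomial α c)).1 x = ev x c • dx α := by
  rw [formHom_apply, Finset.sum_eq_single α]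
  · rw [partialAt, iterD_monomial, if_pos rfl]
    rfl
  · intro β _ h
    rw [partialAt, iterD_monomial, if_neg h, map_zero, zero_smul]
  · simp

theorem edge_eq_sub (k l : Fin (m + 1)) (a : Fin n) :
    edge k l a = edge k 0 a - edge l 0 a := smooth_ext fun x => by
  rw [map_sub, ev_edge, ev_edge, ev_edge]
  ring

/-- Polarization: expand the product of two coordinates of `(x_k - x_0) - (x_l - x_0)`. This is the
source of the antisymmetry of differential forms. -/
theorem edge_mul_edge_add_mem (k l : Fin (m + 1)) (a b : Fin n) :
    edge k 0 a * edge l 0 b + edge k 0 b * edge l 0 a ∈ infIdeal n m := by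
  have : edge k 0 a * edge l 0 b + edge k 0 b * edge l 0 a =
      edge k 0 a * edge k 0 b + edge l 0 a * edge l 0 b - edge k l a * edge k l b := by
    rw [edge_eq_sub k l, edge_eq_sub k l]
    ring
  rw [this]
  exact sub_mem (add_mem (edge_mem _ _ _ _) (edge_mem _ _ _ _)) (edge_mem _ _ _ _)

theorem mk_prod_edge_swap (α : Fin m → Fin n) {k l : Fin m} (h : k ≠ l) :
    Ideal.Quotient.mk (infIdeal n m) (∏ i, edge i.succ 0 (α (Equiv.swap k l i))) =
      - Ideal.Quotient.mk (infIdeal n m) (∏ i, edge i.succ 0 (α i)) := by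
  have hl : l ∈ Finset.univ.erase k := Finset.mem_erase.2 ⟨h.symm, Finset.mem_univ l⟩
  have h1 : ∏ i ∈ (Finset.univ.erase k).erase l,
      edge (m := m) i.succ 0 (α (Equiv.swap k l i)) =
      ∏ i ∈ (Finset.univ.erase k).erase l, edge i.succ 0 (α i) := by
    refine Finset.prod_congr rfl fun i hi => ?_
    simp only [Finset.mem_erase] at hi
    rw [Equiv.swap_apply_of_ne_of_ne hi.2.1 hi.1]
  rw [← Finset.mul_prod_erase _ _ (Finset.mem_univ k), ← Finset.mul_prod_erase _ _ hl, h1,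
    ← Finset.mul_prod_erase _ (fun i : Fin m => edge i.succ 0 (α i)) (Finset.mem_univ k),
    ← Finset.mul_prod_erase _ (fun i : Fin m => edge i.succ 0 (α i)) hl,
    Equiv.swap_apply_left, Equiv.swap_apply_right, eq_neg_iff_add_eq_zero, ← map_add,
    Ideal.Quotient.eq_zero_iff_mem, ← mul_assoc, ← mul_assoc, ← add_mul]
  exact Ideal.mul_mem_right _ _ (edge_mul_edge_add_mem _ _ _ _)

theorem mk_prod_edge_perm (σ : Equiv.Perm (Fin m)) (α : Fin m → Fin n) :
    Ideal.Quotient.mk (infIdeal n m) (∏ i, edge i.succ 0 (α (σ i))) =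
      (Equiv.Perm.sign σ : ℤ) • Ideal.Quotient.mk (infIdeal n m) (∏ i, edge i.succ 0 (α i)) := by
  induction σ using Equiv.Perm.swap_induction_on generalizing α with
  | one => simp
  | swap_mul σ k l h ih =>
    rw [Equiv.Perm.sign_mul, Equiv.Perm.sign_swap h]
    refine (ih (α ∘ Equiv.swap k l)).trans ?_
    simp only [Function.comp_apply]
    rw [mk_prod_edge_swap α h]
    simp

theorem monomial_comp_perm_sub_mem (σ : Equiv.Perm (Fin m)) (α : Fin m → Fin n)
    (c : smooth (Fin n → ℝ)) :
    monomial (α ∘ σ) c - (Equiv.Perm.sign σ : ℤ) • monomial α c ∈ infIdeal n m := by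
  rw [← Ideal.Quotient.eq_zero_iff_mem, monomial, monomial, map_sub, map_zsmul, map_mul, map_mul]
  simp only [Function.comp_apply]
  rw [mk_prod_edge_perm, smul_mul_assoc, sub_self]

/-! ### The functions that vanish in the normalized complex -/

/-- The quotient map from functions on simplices to `Inf_n`, as a homomorphism of groups. -/
def mkHom (n m : ℕ) : smooth (Simplices n m) →+ (InfAb n).obj (.mk m) :=
  (Hom.toRingHom (quotientMk (smooth (Simplices n m)) (infIdeal n m))).toAddMonoidHom

theorem mkHom_surjective : Function.Surjective (mkHom n m) := Ideal.Quotient.mk_surjective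

theorem mkHom_eq_zero_iff {f : smooth (Simplices n m)} : mkHom n m f = 0 ↔ f ∈ infIdeal n m := by
  rw [← map_zero (mkHom n m), ← sub_zero f]
  exact Ideal.Quotient.eq.trans (by rw [sub_zero])

theorem δ_mkHom (i : Fin (m + 2)) (f : smooth (Simplices n m)) :
    (InfAb n).δ i (mkHom n m f) = mkHom n (m + 1) (pullHom (reindex n i.succAbove) f) := rfl

/-- The functions on simplices that vanish in the normalized complex. -/
def degenerate (n m : ℕ) : AddSubgroup (smooth (Simplices n m)) :=
  (cofaceSubgroup (InfAb n) m).comap (mkHom n m)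

theorem mem_degenerate_of_mem {f : smooth (Simplices n m)} (h : f ∈ infIdeal n m) :
    f ∈ degenerate n m := by
  rw [degenerate, AddSubgroup.mem_comap, mkHom_eq_zero_iff.2 h]
  exact zero_mem _

theorem Indep.mem_degenerate {p : Fin m} {f : smooth (Simplices n m)} (h : Indep {p.succ} f) :
    f ∈ degenerate n m := by
  cases m with
  | zero => exact p.elim0
  | succ m =>
    obtain ⟨g, rfl⟩ := h.exists_eq_pullHom
    exact le_iSup (fun i : Fin (m + 1) => ((InfAb n).δ i.succ).hom.range) p ⟨mkHom n m g, rfl⟩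

/-- Each mixed partial differentiates once in every vertex of positive index, hence kills whatever
is independent of one of them. -/
theorem degenerate_le_ker : degenerate n m ≤ (formHom n m).ker := by
  have h : cofaceSubgroup (InfAb n) m ≤ (formHom n m).ker.map (mkHom n m) := by
    cases m with
    | zero => exact bot_le
    | succ m =>
      refine iSup_le fun i => ?_
      rintro _ ⟨a, rfl⟩
      obtain ⟨g, rfl⟩ := mkHom_surjective a
      exact ⟨_, (indep_pullHom_succAbove i.succ g).formHom_eq_zero (Finset.mem_singleton_self _),
        (δ_mkHom i.succ g).symm⟩
  intro f hf
  obtain ⟨g, hg, e⟩ := h hf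
  -- `f` and a function `g` of zero form have the same class in `Inf_n`, so the rest is vanishing on
  -- the ideal.
  have : f - g ∈ infIdeal n m := by
    rw [← mkHom_eq_zero_iff, map_sub, e, sub_self]
  have h2 := formHom_eq_zero_of_mem this
  rw [map_sub, (AddMonoidHom.mem_ker).1 hg, sub_zero] at h2
  exact h2

/-! ### Hadamard's lemma in one vertex, and generation by monomials -/

/-- The linear map that replaces the vertex `x_i` of a simplex by `x_0`. -/
def collapse (n : ℕ) {m : ℕ} (i : Fin (m + 1)) : Simplices n m →L[ℝ] Simplices n m :=
  reindex n (Function.update id i 0)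

theorem collapse_self (i : Fin (m + 1)) (x : Simplices n m) : collapse n i x i = x 0 :=
  congrArg x (Function.update_self _ _ _)

theorem collapse_of_ne {i k : Fin (m + 1)} (h : k ≠ i) (x : Simplices n m) :
    collapse n i x k = x k :=
  congrArg x (Function.update_of_ne h _ _)

theorem Indep.mono {S T : Finset (Fin (m + 1))} (h : S ⊆ T) {f : smooth (Simplices n m)}
    (hf : Indep T f) : Indep S f :=
  fun z hz => hf z fun k hk => hz k fun h' => hk (h h')

theorem Indep.mul {S : Finset (Fin (m + 1))} {f g : smooth (Simplices n m)}
    (hf : Indep S f) (hg : Indep S g) : Indep S (f * g) := fun z hz x => by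
  rw [map_mul, map_mul, hf z hz, hg z hz]

theorem Indep.prod {ι : Type} {S : Finset (Fin (m + 1))} {T : Finset ι}
    {f : ι → smooth (Simplices n m)} (hf : ∀ i ∈ T, Indep S (f i)) : Indep S (∏ i ∈ T, f i) :=
  Finset.prod_induction f (Indep S) (fun _ _ => Indep.mul)
    (fun z _ x => by rw [map_one, map_one]) hf

theorem indep_edge {S : Finset (Fin (m + 1))} {k l : Fin (m + 1)} (hk : k ∉ S) (hl : l ∉ S)
    (a : Fin n) : Indep S (edge k l a) := fun z hz x => by
  simp only [ev_edge, Pi.add_apply, hz k hk, hz l hl, Pi.zero_apply, add_zero]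

theorem Indep.dirD {S : Finset (Fin (m + 1))} {f : smooth (Simplices n m)} (hf : Indep S f)
    (w : Simplices n m) : Indep S (dirD w f) :=
  fun z hz x => dirD_add_of_forall (hf z hz) w x

theorem Indep.pullHom_collapse {S : Finset (Fin (m + 1))} {f : smooth (Simplices n m)}
    (hf : Indep S f) {i : Fin (m + 1)} (hi : i ≠ 0) (h0 : 0 ∉ S) :
    Indep (insert i S) (pullHom (collapse n i) f) := fun z hz x => by
  have h0' : z 0 = 0 := hz 0 (by simp [h0, hi.symm])
  rw [ev_pullHom, ev_pullHom, map_add]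
  refine hf _ (fun k hk => ?_) _
  by_cases h : k = i
  · rw [h, collapse_self, h0']
  · rw [collapse_of_ne h, hz k (by simp [h, hk])]

theorem sub_collapse (i : Fin (m + 1)) (x : Simplices n m) :
    x - collapse n i x = ∑ a, ev x (edge i 0 a) • basisVec i a := by
  ext k a
  rw [Finset.sum_apply, Finset.sum_apply]
  by_cases h : k = i
  · subst h
    rw [Pi.sub_apply, collapse_self]
    simp [ev_edge, basisVec, Pi.single_apply]
  · rw [Pi.sub_apply, collapse_of_ne h, sub_self]
    exact (Finset.sum_eq_zero fun b _ => by rw [Pi.smul_apply, basisVec_of_ne h, smul_zero]; rfl).symm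

/-- Hadamard's lemma along the segment that moves `x_i` to `x_0`: `h a` is the integral of the
partial derivative of `f` in `x_{i,a}`. The condition `0 ∉ S` is needed because collapsing copies
`x_0` into vertex `i`, which may lie in `S`. -/
theorem exists_eq_collapse_add (f : smooth (Simplices n m)) (i : Fin (m + 1)) :
    ∃ h : Fin n → smooth (Simplices n m),
      f = pullHom (collapse n i) f + ∑ a, edge i 0 a * h a ∧
      ∀ S, Indep S f → 0 ∉ S → ∀ a, Indep S (h a) := by
  let P : Simplices n m → ℝ → Simplices n m := fun x t =>
    collapse n i x + t • (x - collapse n i x)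
  have hP : ContDiff ℝ ∞ (Function.uncurry P) := by
    simp only [Function.uncurry_def, P]
    fun_prop
  let G : Fin n → Simplices n m → ℝ → ℝ := fun a x t => ev (P x t) (dirD (basisVec i a) f)
  have hG : ∀ a, ContDiff ℝ ∞ (Function.uncurry (G a)) := fun a => (contDiff_ev _).comp hP
  refine ⟨fun a => ofFn (fun x => ∫ t in (0:ℝ)..1, G a x t)
    (contDiff_infty.2 fun N => contDiff_param N (G a) (hG a)), smooth_ext fun x => ?_,
    fun S hS h0 a z hz x => ?_⟩
  · have hGc : ∀ a, Continuous (G a x) := fun a =>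
      (hG a).continuous.comp (by fun_prop : Continuous fun t : ℝ => (x, t))
    have hd : ∀ t, HasDerivAt (fun t => ev (P x t) f) (∑ a, ev x (edge i 0 a) * G a x t) t := by
      intro t
      have h1 : HasDerivAt (P x) (x - collapse n i x) t := by
        have := ((hasDerivAt_id t).smul_const (x - collapse n i x)).const_add (collapse n i x)
        rw [one_smul] at this
        exact this
      have h2 := (differentiableAt_ev f (P x t)).hasFDerivAt.comp_hasDerivAt t h1
      rw [sub_collapse, map_sum] at h2
      simp only [map_smul] at h2
      exact h2
    have := intervalIntegral.integral_eq_sub_of_hasDerivAt (fun t _ => hd t)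
      ((by fun_prop : Continuous fun t => ∑ a, ev x (edge i 0 a) * G a x t).intervalIntegrable 0 1)
    rw [intervalIntegral.integral_finsetSum
      (fun a _ => (by fun_prop : Continuous _).intervalIntegrable 0 1)] at this
    simp only [intervalIntegral.integral_const_mul] at this
    rw [map_add, map_sum, ← sub_eq_iff_eq_add', ev_pullHom]
    simp only [map_mul, ev_ofFn]
    rw [this]
    simp [P]
  · have h0' : z 0 = 0 := hz 0 h0
    rw [ev_ofFn, ev_ofFn]
    refine intervalIntegral.integral_congr fun t _ => ?_
    -- The path is linear in its starting simplex, and a `z` supported on `S` stays supported on `S`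
    -- along it.
    have : P (x + z) t = P x t + P z t := by
      simp only [P, map_add, smul_add, smul_sub]
      abel
    simp only [G]
    rw [this]
    refine (hS.dirD _) _ (fun k hk => ?_) _
    simp only [P, Pi.add_apply, Pi.smul_apply, Pi.sub_apply]
    have hc : collapse n i z k = 0 := by
      by_cases h : k = i
      · rw [h, collapse_self, h0']
      · rw [collapse_of_ne h, hz k hk]
    rw [hc, hz k hk, sub_zero, smul_zero, add_zero]

/-- The group generated by the products of edge functions of the vertices in `S` with functions that
do not depend on these vertices, and by the degenerate functions. -/
def partialMonomials (n : ℕ) {m : ℕ} (S : Finset (Fin m)) :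
    AddSubgroup (smooth (Simplices n m)) :=
  AddSubgroup.closure {f | ∃ (α : Fin m → Fin n) (g : smooth (Simplices n m)),
    Indep (S.map (Fin.succEmb m)) g ∧ f = (∏ i ∈ S, edge i.succ 0 (α i)) * g} ⊔ degenerate n m

theorem zero_notMem_map_succ (S : Finset (Fin m)) : 0 ∉ S.map (Fin.succEmb m) := by
  simp [Fin.succ_ne_zero]

/-- Expand `g` to second order in vertex `p`: the constant term makes the product independent of
`p`, hence degenerate; the linear terms supply the new edge factor; the quadratic remainder lies in
`infIdeal`. -/
theorem prod_edge_mul_mem_partialMonomials {S : Finset (Fin m)} {p : Fin m} (hp : p ∉ S)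
    (α : Fin m → Fin n) {g : smooth (Simplices n m)} (hg : Indep (S.map (Fin.succEmb m)) g) :
    (∏ i ∈ S, edge i.succ 0 (α i)) * g ∈ partialMonomials n (insert p S) := by
  have hp0 : p.succ ≠ 0 := Fin.succ_ne_zero p
  have hdeg : degenerate n m ≤ partialMonomials n (insert p S) := le_sup_right
  obtain ⟨h, e, hh⟩ := exists_eq_collapse_add g p.succ
  -- The independence of the second remainder is discarded, since its terms are absorbed by the
  -- ideal.
  choose h' e' _ using fun a => exists_eq_collapse_add (h a) p.succ
  have hprod : Indep {p.succ} (∏ i ∈ S, edge i.succ 0 (α i)) := Indep.prod fun i hi =>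
    indep_edge (by simpa using fun e : i = p => hp (e ▸ hi)) (by simpa using hp0.symm) _
  rw [e, mul_add, Finset.mul_sum]
  refine add_mem (hdeg (Indep.mem_degenerate (p := p) (hprod.mul ?_))) (sum_mem fun a _ => ?_)
  · exact (hg.pullHom_collapse hp0 (zero_notMem_map_succ S)).mono (by simp)
  · rw [e' a, mul_add, mul_add]
    refine add_mem (AddSubgroup.mem_sup_left (AddSubgroup.subset_closure
      ⟨Function.update α p a, pullHom (collapse n p.succ) (h a), ?_, ?_⟩))
      (hdeg (mem_degenerate_of_mem ?_))
    · rw [Finset.map_insert]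
      exact (hh _ hg (zero_notMem_map_succ S) a).pullHom_collapse hp0 (zero_notMem_map_succ S)
    · rw [Finset.prod_insert hp, Function.update_self, mul_left_comm, mul_assoc]
      congr 2
      exact Finset.prod_congr rfl fun i hi => by
        rw [Function.update_of_ne fun e : i = p => hp (e ▸ hi)]
    · refine Ideal.mul_mem_left _ _ ?_
      rw [Finset.mul_sum]
      refine Ideal.sum_mem _ fun b _ => ?_
      rw [← mul_assoc]
      exact Ideal.mul_mem_right _ _ (edge_mem _ _ _ _)

/-- The argument `α` only guarantees that an index map exists, as the case `S = ∅` must exhibit one.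
-/
theorem partialMonomials_eq_top (α : Fin m → Fin n) (S : Finset (Fin m)) :
    partialMonomials n S = ⊤ := by
  induction S using Finset.induction_on with
  | empty =>
    refine eq_top_iff.2 fun f _ => AddSubgroup.mem_sup_left (AddSubgroup.subset_closure
      ⟨α, f, fun z hz x => ?_, by simp⟩)
    rw [show z = 0 from funext fun k => hz k (by simp), add_zero]
  | insert p S hp ih =>
    rw [eq_top_iff, ← ih]
    refine sup_le ((AddSubgroup.closure_le _).2 ?_) le_sup_right
    rintro _ ⟨α, g, hg, rfl⟩
    exact prod_edge_mul_mem_partialMonomials hp α hg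

theorem closure_monomial_sup_degenerate :
    AddSubgroup.closure {f | ∃ (α : Fin m → Fin n) (c : smooth (Fin n → ℝ)), f = monomial α c} ⊔
      degenerate n m = ⊤ := by
  rw [eq_top_iff]
  by_cases hα : Nonempty (Fin m → Fin n)
  · obtain ⟨α⟩ := hα
    rw [← partialMonomials_eq_top α Finset.univ]
    refine sup_le_sup_right (AddSubgroup.closure_mono ?_) _
    rintro _ ⟨α, g, hg, rfl⟩
    -- `g` depends on `x_0` alone, so it is recovered from its restriction to the constant
    -- simplices.
    let L : (Fin n → ℝ) →L[ℝ] Simplices n m :=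
      ContinuousLinearMap.pi fun _ => ContinuousLinearMap.id ℝ _
    refine ⟨α, pullHom L g, congrArg _ (smooth_ext fun x => ?_)⟩
    refine (Eq.trans (congrArg (fun y => ev y g) ?_) (hg (L (x 0) - x) (fun k hk => ?_) x)).symm
    · rw [add_sub_cancel]
      rfl
    · obtain rfl : k = 0 := by
        by_contra h
        obtain ⟨i, rfl⟩ := Fin.exists_succ_eq.2 h
        exact hk (by simp)
      exact sub_self _
  -- No index map exists only if `n = 0` and `m > 0`. Then the space of simplices is a point and
  -- every function is independent of every vertex.
  · rw [not_nonempty_iff] at hα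
    obtain ⟨p⟩ : Nonempty (Fin m) := by
      by_contra h
      rw [not_nonempty_iff] at h
      exact hα.false (isEmptyElim)
    have hn : IsEmpty (Fin n) := ⟨fun a => hα.false fun _ => a⟩
    intro f _
    refine AddSubgroup.mem_sup_right (Indep.mem_degenerate (p := p) fun z _ x => ?_)
    rw [show z = 0 from funext fun k => funext fun a => isEmptyElim a, add_zero]

theorem monomial_induction {p : smooth (Simplices n m) → Prop}
    (hm : ∀ α c, p (monomial α c)) (hd : ∀ f ∈ degenerate n m, p f)
    (hs : ∀ f g, p f → p g → p (f - g)) (f : smooth (Simplices n m)) : p f := by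
  have h0 : p 0 := hd 0 (zero_mem _)
  have hneg : ∀ f, p f → p (-f) := fun f hf => by simpa using hs 0 f h0 hf
  let N : AddSubgroup (smooth (Simplices n m)) :=
    { carrier := {f | p f}
      zero_mem' := h0
      add_mem' := fun {f g} hf hg => by simpa using hs f (-g) hf (hneg g hg)
      neg_mem' := fun {f} hf => hneg f hf }
  have h : (⊤ : AddSubgroup (smooth (Simplices n m))) ≤ N := by
    rw [← closure_monomial_sup_degenerate]
    refine sup_le ((AddSubgroup.closure_le N).2 ?_) hd
    rintro _ ⟨α, c, rfl⟩
    exact hm α c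
  exact h (AddSubgroup.mem_top f)

/-! ### The inverse: the function on simplices attached to a form -/

/-- The tuple of standard basis vectors of `ℝ^n` with indices `β`. -/
def stdTuple (β : Fin m → Fin n) : Fin m → Fin n → ℝ := fun i => Pi.single (β i) 1

theorem dx_stdTuple (α β : Fin m → Fin n) : dx α (stdTuple β) =
    ∑ σ : Equiv.Perm (Fin m), ((Equiv.Perm.sign σ : ℤ) : ℝ) * if α = β ∘ σ then 1 else 0 := by
  rw [dx_apply, Matrix.det_apply']
  refine Finset.sum_congr rfl fun σ _ => congrArg _ ?_
  simp only [Matrix.of_apply, stdTuple, Pi.single_apply, funext_iff, Function.comp_apply,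
    Finset.prod_ite_zero, Finset.prod_const_one, Finset.mem_univ, true_imp_iff]

/-- The Leibniz formula for the transposed matrix puts the permutation on `α` instead of `β`. The
first version collapses sums over `α`, this one sums over `β`. -/
theorem dx_stdTuple' (α β : Fin m → Fin n) : dx α (stdTuple β) =
    ∑ σ : Equiv.Perm (Fin m), ((Equiv.Perm.sign σ : ℤ) : ℝ) * if β = α ∘ σ then 1 else 0 := by
  rw [dx_apply, ← Matrix.det_transpose, Matrix.det_apply']
  refine Finset.sum_congr rfl fun σ _ => congrArg _ ?_
  simp only [Matrix.transpose_apply, Matrix.of_apply, stdTuple, Pi.single_apply, funext_iff,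
    Function.comp_apply, Finset.prod_ite_zero, Finset.prod_const_one, Finset.mem_univ,
    true_imp_iff, eq_comm]

/-- The coefficient function of `dx β` in a form, divided by `m!`. -/
def coeff (η : DiffForm n m) (β : Fin m → Fin n) : smooth (Fin n → ℝ) :=
  ofFn (fun x => (m.factorial : ℝ)⁻¹ * η.1 x (stdTuple β))
    (contDiff_const.mul ((ContinuousAlternatingMap.apply ℝ (Fin n → ℝ) ℝ
      (stdTuple β)).contDiff.comp (DiffForm.smooth η)))

theorem ev_coeff (η : DiffForm n m) (β : Fin m → Fin n) (x : Fin n → ℝ) :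
    ev x (coeff η β) = (m.factorial : ℝ)⁻¹ * η.1 x (stdTuple β) := rfl

/-- The function `x ↦ η(x_0)(x_1 - x_0, …, x_m - x_0) / m!` on simplices. -/
def formFn (n m : ℕ) : DiffForm n m →+ smooth (Simplices n m) :=
  AddMonoidHom.mk' (fun η => ∑ β, monomial β (coeff η β)) fun η ξ => by
    have (β : Fin m → Fin n) : coeff (η + ξ) β = coeff η β + coeff ξ β := smooth_ext fun x => by
      rw [map_add, ev_coeff, ev_coeff, ev_coeff, ← mul_add]
      rfl
    simp only [this, monomial, map_add, mul_add, Finset.sum_add_distrib]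

theorem formFn_apply (η : DiffForm n m) : formFn n m η = ∑ β, monomial β (coeff η β) := rfl

/-- Evaluated on basis vectors `γ`, only the rearrangements of `γ` contribute. Each permutation
gives the same term because its sign occurs twice, which accounts for the factor `1 / m!`. -/
theorem sum_smul_dx (η : (Fin n → ℝ) [⋀^Fin m]→L[ℝ] ℝ) :
    ∑ β : Fin m → Fin n, ((m.factorial : ℝ)⁻¹ * η (stdTuple β)) • dx β = η := by
  apply ContinuousAlternatingMap.toAlternatingMap_injective
  refine (Pi.basisFun ℝ (Fin n)).ext_alternating fun γ _ => ?_
  have hγ : (fun i => Pi.basisFun ℝ (Fin n) (γ i)) = stdTuple γ :=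
    funext fun i => Pi.basisFun_apply ℝ (Fin n) (γ i)
  have hperm : ∀ σ : Equiv.Perm (Fin m), η (stdTuple (γ ∘ σ)) =
      ((Equiv.Perm.sign σ : ℤ) : ℝ) * η (stdTuple γ) := fun σ => by
    have := η.toAlternatingMap.map_perm (stdTuple γ) σ
    rw [Units.smul_def, zsmul_eq_mul] at this
    exact this
  rw [hγ]
  change (∑ β : Fin m → Fin n, ((m.factorial : ℝ)⁻¹ * η (stdTuple β)) • dx β) (stdTuple γ) =
    η (stdTuple γ)
  simp only [ContinuousAlternatingMap.sum_apply, ContinuousAlternatingMap.smul_apply, dx_stdTuple,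
    smul_eq_mul, Finset.mul_sum]
  rw [Finset.sum_comm]
  have (σ : Equiv.Perm (Fin m)) : ∑ β : Fin m → Fin n, (m.factorial : ℝ)⁻¹ * η (stdTuple β) *
      (((Equiv.Perm.sign σ : ℤ) : ℝ) * if β = γ ∘ σ then 1 else 0) =
      (m.factorial : ℝ)⁻¹ * η (stdTuple γ) := by
    rw [Finset.sum_eq_single (γ ∘ σ) (fun β _ h => by rw [if_neg h, mul_zero, mul_zero])
      (by simp), if_pos rfl, hperm]
    have : ((Equiv.Perm.sign σ : ℤ) : ℝ) * ((Equiv.Perm.sign σ : ℤ) : ℝ) = 1 := by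
      rw [← Int.cast_mul, ← Units.val_mul, Int.units_mul_self]
      simp
    linear_combination (m.factorial : ℝ)⁻¹ * η (stdTuple γ) * this
  rw [Finset.sum_congr rfl fun σ _ => this σ, Finset.sum_const, Finset.card_univ,
    Fintype.card_perm, Fintype.card_fin, nsmul_eq_mul, ← mul_assoc,
    mul_inv_cancel₀ (by exact_mod_cast m.factorial_ne_zero), one_mul]

theorem formHom_formFn (η : DiffForm n m) : formHom n m (formFn n m η) = η := by
  refine Subtype.ext (funext fun x => ?_)
  rw [formFn_apply, map_sum, AddSubgroup.val_finsetSum, Finset.sum_apply]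
  simp only [formHom_monomial_apply, ev_coeff]
  exact sum_smul_dx _

/-- The form `c dx_α` is sent to the average over all permutations `σ` of `sign σ` times the
monomial of `α ∘ σ`; by antisymmetry modulo the ideal, each of these equals the monomial of `α`. -/
theorem formFn_formHom_monomial (α : Fin m → Fin n) (c : smooth (Fin n → ℝ)) :
    formFn n m (formHom n m (monomial α c)) - monomial α c ∈ infIdeal n m := by
  let c' : smooth (Fin n → ℝ) := ofFn (fun _ => (m.factorial : ℝ)⁻¹) contDiff_const * c
  -- The monomial is split into `m!` equal parts indexed by permutations, to be compared term by
  -- term.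
  have h1 : monomial α c = ∑ _σ : Equiv.Perm (Fin m), monomial α c' := by
    have : c = m.factorial • c' := smooth_ext fun x => by
      rw [map_nsmul, map_mul, ev_ofFn, nsmul_eq_mul, ← mul_assoc,
        mul_inv_cancel₀ (by exact_mod_cast m.factorial_ne_zero), one_mul]
    rw [Finset.sum_const, Finset.card_univ, Fintype.card_perm, Fintype.card_fin]
    conv_lhs => rw [this]
    rw [monomial, map_nsmul, mul_smul_comm]
    rfl
  have h2 (β : Fin m → Fin n) : coeff (formHom n m (monomial α c)) β =
      ∑ σ : Equiv.Perm (Fin m), if β = α ∘ σ then (Equiv.Perm.sign σ : ℤ) • c' else 0 :=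
    smooth_ext fun x => by
      rw [ev_coeff, formHom_monomial_apply, ContinuousAlternatingMap.smul_apply, dx_stdTuple',
        map_sum, smul_eq_mul, Finset.mul_sum, Finset.mul_sum]
      refine Finset.sum_congr rfl fun σ _ => ?_
      split_ifs
      · rw [map_zsmul, map_mul, ev_ofFn, zsmul_eq_mul]
        ring
      · rw [map_zero]
        ring
  have h3 : formFn n m (formHom n m (monomial α c)) =
      ∑ σ : Equiv.Perm (Fin m), (Equiv.Perm.sign σ : ℤ) • monomial (α ∘ σ) c' := by
    rw [formFn_apply]
    simp only [h2]
    simp only [monomial, map_sum, Finset.mul_sum]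
    rw [Finset.sum_comm]
    refine Finset.sum_congr rfl fun σ _ => ?_
    rw [Finset.sum_eq_single (α ∘ σ) (fun β _ h => by rw [if_neg h, map_zero, mul_zero])
      (by simp), if_pos rfl, map_zsmul, mul_smul_comm]
  rw [h3, h1, ← Finset.sum_sub_distrib]
  refine Ideal.sum_mem _ fun σ _ => ?_
  have : (Equiv.Perm.sign σ : ℤ) • monomial (α ∘ σ) c' - monomial α c' =
      (Equiv.Perm.sign σ : ℤ) • (monomial (α ∘ σ) c' - (Equiv.Perm.sign σ : ℤ) • monomial α c') := by
    rw [smul_sub, smul_smul, ← Units.val_mul, Int.units_mul_self, Units.val_one, one_smul]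
  rw [this]
  exact zsmul_mem (monomial_comp_perm_sub_mem σ α c') _

theorem formFn_formHom (f : smooth (Simplices n m)) :
    formFn n m (formHom n m f) - f ∈ degenerate n m := by
  induction f using monomial_induction with
  | hm α c => exact mem_degenerate_of_mem (formFn_formHom_monomial α c)
  | hd f hf =>
    rw [degenerate_le_ker hf, map_zero, zero_sub]
    exact neg_mem hf
  | hs f g hf hg =>
    rw [map_sub, map_sub, sub_sub_sub_comm]
    exact sub_mem hf hg

theorem ker_formHom : (formHom n m).ker = degenerate n m := by
  refine le_antisymm (fun f hf => ?_) degenerate_le_ker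
  have h := formFn_formHom f
  rw [AddMonoidHom.mem_ker.1 hf, map_zero, zero_sub] at h
  exact neg_mem_iff.1 h

/-! ### Compatibility with the differentials -/

theorem iterD_map {V ι κ : Type} [NormedAddCommGroup V] [NormedSpace ℝ V] (e : ι ↪ κ)
    (S : Finset ι) (w : κ → V) (f : smooth V) :
    iterD (S.map e) w f = iterD S (fun i => w (e i)) f := by
  rw [iterD, iterD, Finset.map_val, Multiset.map_map]
  rfl

theorem reindex_succ_basisVec (i : Fin (m + 1)) (a : Fin n) :
    reindex n (Fin.succAbove (0 : Fin (m + 2))) (basisVec i.succ a) = basisVec i a := by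
  funext k
  simp only [reindex, ContinuousLinearMap.coe_pi', ContinuousLinearMap.proj_apply, basisVec,
    Fin.zero_succAbove]
  by_cases h : k = i
  · subst h
    rw [Pi.single_eq_same, Pi.single_eq_same]
  · rw [Pi.single_eq_of_ne h, Pi.single_eq_of_ne fun e => h (Fin.succ_injective _ e)]

/-- After the coface, the monomial has `x_1` as its base point. The derivatives in the later
vertices remove the edge factors and leave `c`; the derivative in `x_1`, taken last, then acts on
`c` alone. -/
theorem partialAt_coface_monomial (α : Fin m → Fin n) (c : smooth (Fin n → ℝ)) (b : Fin n)
    (γ : Fin m → Fin n) (x : Fin n → ℝ) :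
    partialAt (pullHom (reindex n (Fin.succAbove (0 : Fin (m + 2)))) (monomial α c))
      (Fin.cons b γ) x = if γ = α then ev x (dirD (Pi.single b 1) c) else 0 := by
  rw [partialAt, iterD_pullHom]
  simp only [reindex_succ_basisVec]
  rw [Fin.univ_succ, Finset.cons_eq_insert, iterD_insert (by simp [Fin.succ_ne_zero]),
    iterD_map]
  simp only [Function.Embedding.coeFn_mk, Fin.cons_succ, Fin.cons_zero]
  rw [iterD_monomial, ev_pullHom]
  split_ifs
  · have : (ContinuousLinearMap.proj 0 : Simplices n m →L[ℝ] Fin n → ℝ) (basisVec 0 b) =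
        Pi.single b 1 := Pi.single_eq_same (M := fun _ => Fin n → ℝ) (0 : Fin (m + 1)) (Pi.single b 1)
    rw [dirD_pullHom, this]
    rfl
  · rw [map_zero, map_zero]

/-- Expanding the determinant of `dx (b, α)` along its first column, the one for `b`, reproduces the
alternating sum that defines the exterior derivative. -/
theorem formHom_coface_monomial (α : Fin m → Fin n) (c : smooth (Fin n → ℝ)) :
    formHom n (m + 1) (pullHom (reindex n (Fin.succAbove (0 : Fin (m + 2)))) (monomial α c)) =
      deRhamD n m (formHom n m (monomial α c)) := by
  refine Subtype.ext (funext fun x => ?_)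
  have hη : (formHom n m (monomial α c)).1 = fun x => ev x c • dx α :=
    funext fun x => formHom_monomial_apply α c x
  change _ = extDeriv (formHom n m (monomial α c)).1 x
  rw [hη, formHom_apply, ← Equiv.sum_comp (Fin.consEquiv fun _ => Fin n), Fintype.sum_prod_type]
  change (∑ b, ∑ γ : Fin m → Fin n, partialAt _ (Fin.cons b γ) x •
    dx (Fin.cons b γ : Fin (m + 1) → Fin n)) = _
  simp only [partialAt_coface_monomial, ite_smul, zero_smul,
    Finset.sum_ite_eq', Finset.mem_univ, if_true]
  ext v
  rw [extDeriv_apply ((differentiableAt_ev c x).smul_const _)]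
  simp only [ContinuousAlternatingMap.sum_apply, ContinuousAlternatingMap.smul_apply, smul_eq_mul,
    zsmul_eq_mul, Int.cast_pow, Int.cast_neg, Int.cast_one]
  have h1 (i : Fin (m + 1)) : fderiv ℝ (fun y => ev y c * dx α (i.removeNth v)) x (v i) =
      ∑ b, v i b * ev x (dirD (Pi.single b 1) c) * dx α (i.removeNth v) := by
    rw [fderiv_mul_const (differentiableAt_ev c x), ← Finset.sum_mul]
    have hv : v i = ∑ b, v i b • (Pi.single b 1 : Fin n → ℝ) := by
      ext j; simp [Finset.sum_apply, Pi.single_apply]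
    conv_lhs => rw [hv]
    simp only [map_sum, map_smul, smul_apply, smul_eq_mul, ev_dirD, Finset.sum_mul]
    exact Finset.sum_congr rfl fun b _ => by ring
  have h2 (b : Fin n) : dx (Fin.cons b α : Fin (m + 1) → Fin n) v =
      ∑ i : Fin (m + 1), (-1) ^ (i : ℕ) * v i b * dx α (i.removeNth v) := by
    rw [dx_apply, Matrix.det_succ_column_zero]
    rfl
  simp only [h1, h2, Finset.mul_sum]
  rw [Finset.sum_comm]
  exact Finset.sum_congr rfl fun i _ => Finset.sum_congr rfl fun b _ => by ring

theorem formHom_coface (f : smooth (Simplices n m)) :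
    formHom n (m + 1) (pullHom (reindex n (Fin.succAbove (0 : Fin (m + 2)))) f) =
      deRhamD n m (formHom n m f) := by
  induction f using monomial_induction with
  | hm α c => exact formHom_coface_monomial α c
  | hd f hf =>
    -- Both sides vanish, since `d^0` carries degenerate functions to degenerate functions.
    rw [degenerate_le_ker hf, map_zero]
    refine degenerate_le_ker ?_
    exact cofaceSubgroup_le (InfAb n) m hf
  | hs f g hf hg => rw [map_sub, map_sub, map_sub, map_sub, hf, hg]

/-! ### The isomorphism of complexes -/

/-- The projection from functions on simplices to the normalized complex. -/
def toNormalizedHom (n m : ℕ) : smooth (Simplices n m) →+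
    (InfAb n).obj (.mk m) ⧸ cofaceSubgroup (InfAb n) m :=
  (QuotientAddGroup.mk' (cofaceSubgroup (InfAb n) m)).comp (mkHom n m)

theorem toNormalizedHom_surjective : Function.Surjective (toNormalizedHom n m) :=
  (QuotientAddGroup.mk'_surjective _).comp mkHom_surjective

theorem ker_toNormalizedHom : (toNormalizedHom n m).ker = degenerate n m := by
  rw [toNormalizedHom, ← AddMonoidHom.comap_ker, QuotientAddGroup.ker_mk']
  rfl

/-- The isomorphism from the normalized complex of `Inf_n` to differential forms, in one degree. -/
def normalizedEquiv (n m : ℕ) :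
    (InfAb n).obj (.mk m) ⧸ cofaceSubgroup (InfAb n) m ≃+ DiffForm n m :=
  (QuotientAddGroup.quotientKerEquivOfSurjective _ toNormalizedHom_surjective).symm.trans
    ((QuotientAddGroup.quotientAddEquivOfEq (ker_toNormalizedHom.trans ker_formHom.symm)).trans
      (QuotientAddGroup.quotientKerEquivOfSurjective (formHom n m)
        fun η => ⟨_, formHom_formFn η⟩))

theorem normalizedEquiv_apply (f : smooth (Simplices n m)) :
    normalizedEquiv n m (toNormalizedHom n m f) = formHom n m f := by
  have : (QuotientAddGroup.quotientKerEquivOfSurjective _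
      toNormalizedHom_surjective).symm (toNormalizedHom n m f) = QuotientAddGroup.mk f :=
    (AddEquiv.symm_apply_eq _).2 rfl
  rw [normalizedEquiv, AddEquiv.trans_apply, this]
  rfl

theorem normalizedEquiv_δ (a : (InfAb n).obj (.mk m)) :
    normalizedEquiv n (m + 1) (QuotientAddGroup.mk ((InfAb n).δ 0 a)) =
      deRhamD n m (normalizedEquiv n m (QuotientAddGroup.mk a)) := by
  obtain ⟨f, rfl⟩ := mkHom_surjective a
  exact (normalizedEquiv_apply _).trans ((formHom_coface f).trans
    (congrArg _ (normalizedEquiv_apply f).symm))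

theorem normalizedEquiv_comm (m : ℕ) :
    (normalizedEquiv n m).toAddCommGrpIso.hom ≫ (deRham n).d m (m + 1) =
      (normalizedComplex (InfAb n)).d m (m + 1) ≫
        (normalizedEquiv n (m + 1)).toAddCommGrpIso.hom := by
  have h1 : (deRham n).d m (m + 1) = AddCommGrpCat.ofHom (deRhamD n m) :=
    CochainComplex.of_d (fun m => AddCommGrpCat.of (DiffForm n m))
      (fun m => AddCommGrpCat.ofHom (deRhamD n m)) m
  have h2 : (normalizedComplex (InfAb n)).d m (m + 1) = normalizedD (InfAb n) m :=
    CochainComplex.of_d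
      (fun m => AddCommGrpCat.of ((InfAb n).obj (.mk m) ⧸ cofaceSubgroup (InfAb n) m))
      (normalizedD (InfAb n)) m
  rw [h1, h2]
  refine AddCommGrpCat.hom_ext (AddMonoidHom.ext fun b => ?_)
  obtain ⟨a, rfl⟩ := QuotientAddGroup.mk_surjective b
  exact (normalizedEquiv_δ a).symm

/-- The isomorphism from the normalized complex of `Inf_n` to the de Rham complex of `ℝ^n`. -/
def normalizedIso (n : ℕ) : normalizedComplex (InfAb n) ≅ deRham n :=
  HomologicalComplex.Hom.isoOfComponents (fun m => (normalizedEquiv n m).toAddCommGrpIso)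
    fun i j h => by
      obtain rfl : i + 1 = j := h
      exact normalizedEquiv_comm i

end CInf

end

theorem mainTheorem1 (n : ℕ) :
    ∃ e : CInf.normalizedComplex (CInf.InfAb n) ≅ CInf.deRham n,
      (∀ (m : ℕ) (f : CInf.SmoothFn (CInf.Simplices n m)),
        e.hom.f m (CInf.toNormalized (CInf.InfAb n) m (CInf.InfAb.mk n m f)) =
          (CInf.simplexForm f : CInf.DiffForm n m)) ∧
      (∀ (m : ℕ) (a : (CInf.InfAb n).obj (SimplexCategory.mk m)),
        e.hom.f (m + 1) (CInf.toNormalized (CInf.InfAb n) (m + 1) ((CInf.InfAb n).δ 0 a)) =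
          CInf.deRhamD n m (e.hom.f m (CInf.toNormalized (CInf.InfAb n) m a))) :=
  ⟨CInf.normalizedIso n, fun _ f => CInf.normalizedEquiv_apply f,
    fun _ a => CInf.normalizedEquiv_δ a⟩
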